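/- All simplicial complexes here are finite abstract simplicial complexes. A face $\delta$ of a complex $C$ is *free* if it is contained in exactly one face of $C$ of dimension $\dim\delta+1$; an *elementary collapse* of $C$ removes a free face $\delta$ together with the unique face properly containing it. A complex is *collapsible* if some sequence of elementary collapses reduces it to a single vertex, and *extendably collapsible* if every complex reached from it by a (possibly empty) sequence of elementary collapses is collapsible, i.e. every sequence of elementary collapses can be continued to one that ends in a single vertex. Let $S$ be a triangulation of the 3-sphere, i.e. a pure 3-dimensional simplicial complex whose underlying topological space is homeomorphic to $S^3$. Let its $f$-vector be $(f_0,f_1,f_2,f_3)=(v,\,v+n,\,2n,\,n)$, where $f_i$ is the number of $i$-dimensional faces of $S$. Let $\Delta$ be any tetrahedron of $S$, and let $B = S\setminus\{\Delta\}$ be the complex (a triangulated 3-ball) obtained from $S$ by removing $\Delta$ (keeping all its proper faces). If $v<8$ or $n<16$, then $B$ is extendably collapsible. -/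

import Mathlib

namespace PreAbstractSimplicialComplex

/-- The underlying topological space of a finite abstract simplicial complex, in barycentric
coordinates: the points of the standard simplex on all potential vertices whose support lies in a
face.  It carries the subspace topology from `V → ℝ`. -/
def realization {V : Type*} [Fintype V] (K : PreAbstractSimplicialComplex V) : Set (V → ℝ) :=
  {x | x ∈ stdSimplex ℝ V ∧ ∃ σ ∈ K.faces, ∀ i, x i ≠ 0 → i ∈ σ}

/-- `K` is a pure complex of dimension `d`: every face lies in a face with `d + 1` vertices
(so that, in particular, no face has more than `d + 1` vertices). -/
def IsPure {V : Type*} (K : PreAbstractSimplicialComplex V) (d : ℕ) : Prop :=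
  ∀ σ ∈ K.faces, ∃ τ ∈ K.faces, σ ⊆ τ ∧ τ.card = d + 1

/-- A triangulation of the `d`-sphere: a pure `d`-dimensional finite complex whose underlying
topological space is homeomorphic to the unit sphere of `ℝ^(d+1)`. -/
def IsSphereTriangulation {V : Type*} [Fintype V] (K : PreAbstractSimplicialComplex V)
    (d : ℕ) : Prop :=
  K.IsPure d ∧
    Nonempty (K.realization ≃ₜ Metric.sphere (0 : EuclideanSpace ℝ (Fin (d + 1))) 1)

/-- The `f`-vector `(f_0, …, f_d)`, where `f_i` is the number of `i`-dimensional faces, that is,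
of faces with `i + 1` vertices. -/
noncomputable def fVector {V : Type*} (K : PreAbstractSimplicialComplex V) (d : ℕ) :
    Fin (d + 1) → ℕ :=
  fun i => {σ | σ ∈ K.faces ∧ σ.card = (i : ℕ) + 1}.ncard

/-- Removal of a face `δ` from `K`, together with all faces that contain `δ`. If `δ` is a facet,
then only `δ` itself is removed. -/
def removeFace {V : Type*} (K : PreAbstractSimplicialComplex V) (δ : Finset V) :
    PreAbstractSimplicialComplex V where
  faces := {σ | σ ∈ K.faces ∧ ¬ δ ⊆ σ}
  isRelLowerSet_faces := fun _ h =>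
    ⟨(K.isRelLowerSet_faces h.1).1, fun _ hts ht =>
      ⟨(K.isRelLowerSet_faces h.1).2 hts ht, fun hδ => h.2 (hδ.trans hts)⟩⟩

/-- A face `δ` is free if its node in the Hasse diagram has outgoing degree one, that is, if it is
contained in exactly one face of `K` with one more vertex. -/
def IsFree {V : Type*} (K : PreAbstractSimplicialComplex V) (δ : Finset V) : Prop :=
  δ ∈ K.faces ∧ ∃! τ : Finset V, τ ∈ K.faces ∧ δ ⊆ τ ∧ τ.card = δ.card + 1

/-- `L` arises from `K` by an elementary collapse, the removal of a free face. -/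
def ElementaryCollapse {V : Type*} (K L : PreAbstractSimplicialComplex V) : Prop :=
  ∃ δ : Finset V, K.IsFree δ ∧ L = K.removeFace δ

/-- `L` arises from `K` by a finite, possibly empty, sequence of elementary collapses. -/
def CollapsesTo {V : Type*} (K L : PreAbstractSimplicialComplex V) : Prop :=
  Relation.ReflTransGen ElementaryCollapse K L

/-- `K` is collapsible: some sequence of elementary collapses ends in a single vertex. -/
def IsCollapsible {V : Type*} (K : PreAbstractSimplicialComplex V) : Prop :=
  ∃ (L : PreAbstractSimplicialComplex V) (x : V), K.CollapsesTo L ∧ L.faces = {{x}}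

/-- `K` is extendably collapsible: every sequence of elementary collapses that starts at `K` can be
continued to one that ends in a single vertex. -/
def IsExtendablyCollapsible {V : Type*} (K : PreAbstractSimplicialComplex V) : Prop :=
  ∀ L : PreAbstractSimplicialComplex V, K.CollapsesTo L → L.IsCollapsible

end PreAbstractSimplicialComplex

/-! Collapse as far as possible. The claim is that a complex $K$ reached from $B$ in which no face
is free is a single vertex. Three properties survive every collapse (`IsRemnant`): Euler
characteristic 1, connectedness, and the property that a set of tetrahedra avoiding $\Delta$ lies in
$K$ as soon as its mod 2 boundary does. A proper nonempty set of tetrahedra of $S$ always has a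
triangle that lies in exactly one of them, so $K$ contains no tetrahedron. If it contains no
triangle either, it is a connected graph of Euler characteristic 1 without leaves, hence a vertex.

Suppose $K$ does contain triangles. None of its edges lies in exactly one of them. Since
$H_2(S;\mathbb Z/2)=0$, a 2-cycle in $K$ bounds a set of tetrahedra, and the third property forces
that set to be empty or everything, so the cycle is zero. The triangles thus form a dunce-hat-like
family, an `IsCore`. The $n$ tetrahedra of $S$ are linked to each other through triangles missing
from $K$; this takes at least $n-1$ of the $2n$ triangles, so $K$ has at most $n+1$. But
`IsCore.bounds` gives at least 8 vertices and 17 triangles, against $v<8$ or $n<16$.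

The bound on cores is combinatorial. Ranks of boundary matrices together with parity of edge degrees
leave one small candidate: 15 triangles on the complete graph with 7 vertices, where exactly three
edges, forming a triangle, have degree three. Such a family turns out to contain a 2-cycle after
all.

The topology of the 3-sphere enters through three facts collected in `IsPseudoSphere`. No triangle
lies in just one tetrahedron, by the no-retraction theorem. The tetrahedra are strongly connected,
since a splitting along an edge would give a nontrivial $\mathbb Z/2$-cocycle on a punctured ball.
Simplicial 1-cocycles are coboundaries, since the sphere is covered by two charts with connected
overlap. With the $f$-vector, the first fact sharpens to "exactly two", and the vanishing of $H_2$
follows by counting ranks. -/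

namespace NoRetraction

/-! ### The no-retraction theorem in dimension three, by a volume computation. -/

open Set Metric MeasureTheory Filter Topology

/-- Euclidean three-space. -/
abbrev E3 := EuclideanSpace ℝ (Fin 3)

theorem det_one_add_smul_fin_three (M : Matrix (Fin 3) (Fin 3) ℝ) (t : ℝ) :
    (1 + t • M).det = 1 + t * (M 0 0 + M 1 1 + M 2 2) +
      t ^ 2 * (M 0 0 * M 1 1 - M 0 1 * M 1 0 + M 0 0 * M 2 2 - M 0 2 * M 2 0 +
        M 1 1 * M 2 2 - M 1 2 * M 2 1) + t ^ 3 * M.det := by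
  simp [Matrix.det_fin_three]
  ring

/-- The matrix of a continuous linear endomorphism of Euclidean three-space. -/
noncomputable def matrixOf (A : E3 →L[ℝ] E3) : Matrix (Fin 3) (Fin 3) ℝ :=
  Matrix.of fun i j => A (EuclideanSpace.single j 1) i

theorem det_one_add_smul_eq (A : E3 →L[ℝ] E3) (t : ℝ) :
    (1 + t • A).det = (1 + t • matrixOf A).det := by
  have h : LinearMap.toMatrix (EuclideanSpace.basisFun (Fin 3) ℝ).toBasis
      (EuclideanSpace.basisFun (Fin 3) ℝ).toBasis ((1 + t • A : E3 →L[ℝ] E3) : E3 →ₗ[ℝ] E3) =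
      1 + t • matrixOf A := by
    ext i j
    simp [LinearMap.toMatrix_apply, matrixOf, Matrix.one_apply]
  rw [← h, LinearMap.det_toMatrix]

/-- If `∫ det (1 + t A(x)) dx` over a compact set is constant for small `t`, it is constant. -/
theorem integral_det_one_add_eq {A : E3 → (E3 →L[ℝ] E3)} (hA : Continuous A) {B : Set E3}
    (hB : IsCompact B) {δ c : ℝ} (hδ : 0 < δ)
    (h : ∀ t, 0 ≤ t → t < δ → ∫ x in B, (1 + t • A x).det = c) :
    ∫ x in B, (1 + A x).det = c := by
  have hM : ∀ i j, Continuous fun x => matrixOf (A x) i j := fun i j => by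
    simp only [matrixOf, Matrix.of_apply]
    fun_prop
  let p1 : E3 → ℝ := fun x => matrixOf (A x) 0 0 + matrixOf (A x) 1 1 + matrixOf (A x) 2 2
  let p2 : E3 → ℝ := fun x => matrixOf (A x) 0 0 * matrixOf (A x) 1 1
    - matrixOf (A x) 0 1 * matrixOf (A x) 1 0 + matrixOf (A x) 0 0 * matrixOf (A x) 2 2
    - matrixOf (A x) 0 2 * matrixOf (A x) 2 0 + matrixOf (A x) 1 1 * matrixOf (A x) 2 2
    - matrixOf (A x) 1 2 * matrixOf (A x) 2 1
  let p3 : E3 → ℝ := fun x => (matrixOf (A x)).det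
  have c1 : Continuous p1 := by fun_prop
  have c2 : Continuous p2 := by fun_prop
  have c3 : Continuous p3 := by
    simp only [p3, Matrix.det_fin_three]
    fun_prop
  have int : ∀ p : E3 → ℝ, Continuous p → IntegrableOn p B := fun p hp =>
    hp.continuousOn.integrableOn_compact hB
  have key : ∀ t : ℝ, ∫ x in B, (1 + t • A x).det =
      (∫ x in B, (1 : ℝ)) + t * (∫ x in B, p1 x) + t ^ 2 * (∫ x in B, p2 x)
        + t ^ 3 * ∫ x in B, p3 x := by
    intro t
    simp_rw [det_one_add_smul_eq, det_one_add_smul_fin_three]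
    rw [integral_add, integral_add, integral_add, integral_const_mul, integral_const_mul,
      integral_const_mul]
    · exact int _ continuous_const
    · exact (int _ c1).const_mul _
    · exact (int _ continuous_const).add ((int _ c1).const_mul _)
    · exact (int _ c2).const_mul _
    · exact ((int _ continuous_const).add ((int _ c1).const_mul _)).add ((int _ c2).const_mul _)
    · exact (int _ c3).const_mul _
  -- The integral is a cubic polynomial in $t$. The four points $0, s, 2s, 3s$ with $s = \delta/4$
  -- lie below $\delta$ and suffice to show that it is constant.
  have e0 := (key 0).symm.trans (h 0 le_rfl hδ)
  have e1 := (key (δ / 4)).symm.trans (h _ (by positivity) (by linarith))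
  have e2 := (key (2 * (δ / 4))).symm.trans (h _ (by positivity) (by linarith))
  have e3 := (key (3 * (δ / 4))).symm.trans (h _ (by positivity) (by linarith))
  have e := key 1
  simp only [one_smul] at e
  rw [e]
  have hs : 0 < δ / 4 := by positivity
  generalize δ / 4 = s at *
  generalize (∫ x in B, p1 x) = a at *
  generalize (∫ x in B, p2 x) = b at *
  generalize (∫ x in B, p3 x) = d at *
  generalize (∫ x in B, (1 : ℝ)) = v at *
  have hv : v = c := by linarith
  subst hv
  have hd : d = 0 := by
    have : s ^ 3 * d = 0 := by linarith
    simpa [hs.ne'] using this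
  subst hd
  have hb : b = 0 := by
    have : s ^ 2 * b = 0 := by linarith
    simpa [hs.ne'] using this
  subst hb
  have ha : a = 0 := by
    have : s * a = 0 := by linarith
    simpa [hs.ne'] using this
  subst ha
  ring

/-- By the Neumann series $1+sA$ is invertible for all $s\in[0,t]$, so the determinant cannot change
sign on the way from its value 1 at $s=0$. -/
theorem det_one_add_smul_pos {A : E3 →L[ℝ] E3} {t : ℝ} (ht : 0 ≤ t) (h : t * ‖A‖ < 1) :
    0 < (1 + t • A).det := by
  have hne : ∀ s ∈ Icc 0 t, (1 + s • A).det ≠ 0 := by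
    intro s hs h0
    have hu : IsUnit (1 - (-(s • A))) := isUnit_one_sub_of_norm_lt_one <| by
      rw [norm_neg, norm_smul, Real.norm_of_nonneg hs.1]
      exact (mul_le_mul_of_nonneg_right hs.2 (norm_nonneg _)).trans_lt h
    rw [sub_neg_eq_add] at hu
    have h2 : IsUnit (LinearMap.det ((1 + s • A : E3 →L[ℝ] E3) : E3 →ₗ[ℝ] E3)) := by
      obtain ⟨u, hu⟩ := hu
      have h3 := congrArg (fun L : E3 →L[ℝ] E3 => LinearMap.det (L : E3 →ₗ[ℝ] E3)) u.mul_inv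
      simp only [ContinuousLinearMap.toLinearMap_mul, ContinuousLinearMap.toLinearMap_one,
        map_mul, map_one] at h3
      rw [← hu]
      exact IsUnit.of_mul_eq_one _ h3
    exact h2.ne_zero h0
  by_contra hle
  have hc : ContinuousOn (fun s : ℝ => (1 + s • A).det) (Icc 0 t) := by
    have : (fun s : ℝ => (1 + s • A).det) = fun s => (1 + s • matrixOf A).det := by
      ext s; exact det_one_add_smul_eq A s
    rw [this]
    simp_rw [det_one_add_smul_fin_three]
    fun_prop
  have h0 : (0 : ℝ) ∈ Icc ((1 + t • A).det) ((1 + (0 : ℝ) • A).det) := by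
    refine ⟨not_lt.mp hle, ?_⟩
    rw [det_one_add_smul_eq, zero_smul, add_zero, Matrix.det_one]
    exact zero_le_one
  obtain ⟨s, hs, hs0⟩ := intermediate_value_Icc' ht hc h0
  exact hne s hs hs0

/-- The image of the open ball is open because the map is open there, and relatively closed in the
open ball by compactness, since boundary points are fixed. Connectedness of the ball then gives
surjectivity. Injectivity keeps interior points off the boundary sphere. -/
theorem image_closedBall_eq {R : ℝ} {f : E3 → E3} (hR : 0 < R)
    (hf : Continuous f) (hinj : InjOn f (closedBall 0 R))
    (hmaps : MapsTo f (closedBall 0 R) (closedBall 0 R)) (hid : ∀ x ∈ sphere 0 R, f x = x)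
    (hopen : ∀ x ∈ ball (0 : E3) R, map f (𝓝 x) = 𝓝 (f x)) :
    f '' closedBall 0 R = closedBall 0 R := by
  have hsub : f '' ball 0 R ⊆ ball 0 R := by
    rintro _ ⟨x, hx, rfl⟩
    have h1 := hmaps (ball_subset_closedBall hx)
    rw [mem_closedBall_zero_iff] at h1
    rw [mem_ball_zero_iff]
    refine h1.lt_of_ne fun h => ?_
    have h2 : f x ∈ sphere (0 : E3) R := by simpa using h
    have h3 := hinj (ball_subset_closedBall hx) (sphere_subset_closedBall h2) (hid _ h2).symm
    rw [← h3] at h2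
    exact hx.ne h2
  have hop : IsOpen (f '' ball 0 R) := by
    rw [isOpen_iff_mem_nhds]
    rintro _ ⟨x, hx, rfl⟩
    rw [← hopen x hx]
    exact image_mem_map (isOpen_ball.mem_nhds hx)
  have hball : ball 0 R ⊆ f '' ball 0 R := by
    refine (convex_ball (0 : E3) R).isPreconnected.subset_of_closure_inter_subset hop ?_ ?_
    · exact ⟨f 0, hsub ⟨0, by simpa using hR, rfl⟩, 0, by simpa using hR, rfl⟩
    · rintro y ⟨hy, hyb⟩
      have hcl : IsClosed (f '' closedBall 0 R) :=
        ((isCompact_closedBall 0 R).image hf).isClosed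
      obtain ⟨x, hx, rfl⟩ := closure_minimal (image_mono ball_subset_closedBall) hcl hy
      refine ⟨x, ?_, rfl⟩
      rw [mem_closedBall_zero_iff] at hx
      rw [mem_ball_zero_iff]
      refine hx.lt_of_ne fun h => ?_
      have h2 : x ∈ sphere (0 : E3) R := by simpa using h
      rw [hid x h2] at hyb
      simp [h] at hyb
  refine Subset.antisymm hmaps.image_subset fun y hy => ?_
  rcases (mem_closedBall_zero_iff.mp hy).lt_or_eq with h | h
  · exact image_mono ball_subset_closedBall (hball (by simpa using h))
  · exact ⟨y, hy, hid y (by simpa using h)⟩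

/-- There is no `C¹` retraction of a closed ball in three-space onto its boundary. -/
theorem no_contDiff_retraction {R : ℝ} (hR : 0 < R) {G : E3 → E3} (hG : ContDiff ℝ 1 G)
    (hn : ∀ x, ‖G x‖ = R) (hid : ∀ x ∈ sphere 0 R, G x = x) : False := by
  let φ : E3 → E3 := fun x => G x - x
  have hφ : ContDiff ℝ 1 φ := hG.sub contDiff_id
  have hφd : Differentiable ℝ φ := hφ.differentiable one_ne_zero
  have hφc : Continuous (fderiv ℝ φ) := hφ.continuous_fderiv one_ne_zero
  obtain ⟨K₀, hK₀⟩ := (isCompact_closedBall (0 : E3) R).exists_bound_of_continuousOn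
    hφc.continuousOn
  set K := max K₀ 1
  have hK : ∀ x ∈ closedBall (0 : E3) R, ‖fderiv ℝ φ x‖ ≤ K := fun x hx =>
    (hK₀ x hx).trans (le_max_left _ _)
  have hK1 : 1 ≤ K := le_max_right _ _
  -- The derivative of $G$ takes values orthogonal to $G(x)\neq 0$, because $\|G\|$ is constant;
  -- hence it is not surjective.
  have hdet1 : ∀ x, (1 + fderiv ℝ φ x).det = 0 := by
    intro x
    have hd : HasFDerivAt G (1 + fderiv ℝ φ x) x := by
      have h1 : HasFDerivAt φ (fderiv ℝ φ x) x := (hφd x).hasFDerivAt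
      have h2 : G = id + φ := by
        ext y
        simp [φ]
      rw [h2]
      exact (hasFDerivAt_id x).add h1
    have hperp : ∀ v, inner ℝ (G x) ((1 + fderiv ℝ φ x) v) = 0 := by
      intro v
      have h1 := (hd.inner ℝ hd)
      have h2 : (fun t => inner ℝ (G t) (G t)) = fun _ => R ^ 2 := by
        ext t; rw [real_inner_self_eq_norm_sq, hn]
      rw [h2] at h1
      have h3 := congrArg (fun L : E3 →L[ℝ] ℝ => L v) (h1.unique (hasFDerivAt_const _ _))
      simp [fderivInnerCLM_apply, real_inner_comm] at h3
      simpa [real_inner_comm, inner_add_left, inner_add_right] using h3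
    by_contra hne
    have hu : IsUnit (LinearMap.det ((1 + fderiv ℝ φ x : E3 →L[ℝ] E3) : E3 →ₗ[ℝ] E3)) :=
      isUnit_iff_ne_zero.mpr hne
    have hs := (LinearEquiv.ofIsUnitDet (f := ((1 + fderiv ℝ φ x : E3 →L[ℝ] E3) : E3 →ₗ[ℝ] E3))
      (v := (EuclideanSpace.basisFun (Fin 3) ℝ).toBasis)
      (v' := (EuclideanSpace.basisFun (Fin 3) ℝ).toBasis) (by
        rwa [LinearMap.det_toMatrix])).surjective (G x)
    obtain ⟨v, hv⟩ := hs
    have h4 := hperp v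
    change (1 + fderiv ℝ φ x) v = G x at hv
    rw [hv, real_inner_self_eq_norm_sq, hn] at h4
    exact hR.ne' (by simpa using h4)
  -- For $tK<1$ the map $x+t\varphi(x)$ is a bijection of the closed ball onto itself with positive
  -- Jacobian, so the change of variables formula gives the volume of the ball.
  have hconst : ∀ t, 0 ≤ t → t < 1 / K →
      ∫ x in closedBall (0 : E3) R, (1 + t • fderiv ℝ φ x).det =
        volume.real (closedBall (0 : E3) R) := by
    intro t ht htK
    have htK' : t * K < 1 := by rwa [lt_div_iff₀ (by linarith)] at htK
    have ht1 : t ≤ 1 := by nlinarith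
    have hpos : ∀ x ∈ closedBall (0 : E3) R, 0 < (1 + t • fderiv ℝ φ x).det := fun x hx =>
      det_one_add_smul_pos ht ((mul_le_mul_of_nonneg_left (hK x hx) ht).trans_lt htK')
    let f : E3 → E3 := fun x => x + t • φ x
    have hfs : ∀ x, HasStrictFDerivAt f (1 + t • fderiv ℝ φ x) x := fun x =>
      (hasStrictFDerivAt_id x).add ((hφ.contDiffAt.hasStrictFDerivAt one_ne_zero).const_smul t)
    have hinj : InjOn f (closedBall 0 R) := by
      intro x hx y hy hxy
      have h1 : ‖φ y - φ x‖ ≤ K * ‖y - x‖ :=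
        (convex_closedBall (0 : E3) R).norm_image_sub_le_of_norm_fderiv_le
          (fun z _ => hφd z) hK hx hy
      have h2 : y - x = -(t • (φ y - φ x)) := by
        simp only [f] at hxy
        rw [smul_sub, eq_comm, neg_eq_iff_add_eq_zero, ← sub_eq_zero.mpr hxy.symm]
        abel
      have h3 : ‖y - x‖ ≤ t * (K * ‖y - x‖) := by
        calc ‖y - x‖ = t * ‖φ y - φ x‖ := by
              conv_lhs => rw [h2]
              rw [norm_neg, norm_smul, Real.norm_of_nonneg ht]
          _ ≤ _ := mul_le_mul_of_nonneg_left h1 ht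
      have h4 : ‖y - x‖ = 0 := by
        by_contra hne
        have : 0 < ‖y - x‖ := lt_of_le_of_ne (norm_nonneg _) (Ne.symm hne)
        nlinarith
      exact (sub_eq_zero.mp (norm_eq_zero.mp h4)).symm
    have himg : f '' closedBall 0 R = closedBall 0 R := by
      refine image_closedBall_eq hR ?_ hinj ?_ ?_ ?_
      · exact continuous_id.add (hφ.continuous.const_smul t)
      · intro x hx
        have : f x = (1 - t) • x + t • G x := by
          simp only [f, φ, smul_sub, sub_smul, one_smul]
          abel
        rw [this]
        exact (convex_closedBall (0 : E3) R) hx (by simp [hn]) (by linarith) ht (by ring)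
      · intro x hx
        simp [f, φ, hid x hx]
      · intro x hx
        refine (hfs x).map_nhds_eq_of_surj ?_
        rw [LinearMap.range_eq_top]
        exact (LinearEquiv.ofIsUnitDet
          (f := ((1 + t • fderiv ℝ φ x : E3 →L[ℝ] E3) : E3 →ₗ[ℝ] E3))
          (v := (EuclideanSpace.basisFun (Fin 3) ℝ).toBasis)
          (v' := (EuclideanSpace.basisFun (Fin 3) ℝ).toBasis) (by
            rw [LinearMap.det_toMatrix]
            exact isUnit_iff_ne_zero.mpr (hpos x (ball_subset_closedBall hx)).ne')).surjective
    have hint := integral_image_eq_integral_abs_det_fderiv_smul volume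
      (measurableSet_closedBall (x := (0 : E3)) (ε := R))
      (fun x _ => (hfs x).hasFDerivAt.hasFDerivWithinAt) hinj (fun _ => (1 : ℝ))
    rw [himg] at hint
    simp only [integral_const, smul_eq_mul, mul_one, measureReal_restrict_apply_univ] at hint
    rw [hint]
    exact setIntegral_congr_fun measurableSet_closedBall fun x hx => (abs_of_pos (hpos x hx)).symm
  have h1 := integral_det_one_add_eq hφc (isCompact_closedBall 0 R) (by positivity) hconst
  simp only [hdet1, integral_zero] at h1
  have h2 : 0 < volume.real (closedBall (0 : E3) R) :=
    ENNReal.toReal_pos (measure_closedBall_pos _ _ hR).ne' measure_closedBall_lt_top.ne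
  exact h2.ne h1

/-- A continuous self-map of a closed ball of three-space that fixes the boundary sphere
pointwise has the centre in its image. -/
theorem exists_zero_of_eq_id_on_sphere {r : ℝ} (hr : 0 < r) {f : E3 → E3}
    (hf : ContinuousOn f (closedBall 0 r)) (hid : ∀ x ∈ sphere 0 r, f x = x) :
    ∃ x ∈ closedBall (0 : E3) r, f x = 0 := by
  classical
  by_contra! hne
  let φ : E3 → E3 := fun x => if ‖x‖ ≤ r then f x - x else 0
  have hφ : Continuous φ := by
    refine continuous_if_le continuous_norm continuous_const ?_ continuousOn_const ?_
    · have : {x : E3 | ‖x‖ ≤ r} = closedBall 0 r := by ext; simp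
      rw [this]
      exact hf.sub continuousOn_id
    · intro x hx
      rw [hid x (by simpa using hx), sub_self]
  have hsupp : ∀ x, r ≤ ‖x‖ → φ x = 0 := by
    intro x hx
    rcases hx.lt_or_eq with h | h
    · simp [φ, h]
    · simp [φ, hid x (by simpa using h.symm)]
  have hpos : ∀ x, 0 < ‖x + φ x‖ := by
    intro x
    rw [norm_pos_iff]
    by_cases h : ‖x‖ ≤ r
    · simp only [φ, h, if_true, add_sub_cancel]
      exact hne x (by simpa using h)
    · rw [hsupp x (not_le.mp h).le, add_zero]
      rintro rfl
      exact h (by simpa using hr.le)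
  -- The displacement is approximated rather than the map. The support of $\psi$ stays inside that
  -- of $\varphi$, so the smoothed map is still exactly the identity outside the ball; the error
  -- bound keeps it away from zero, and normalising it yields a forbidden retraction.
  obtain ⟨ψ, hψ, happ, hψs⟩ := hφ.exists_contDiff_approx 1 (ε := fun x => ‖x + φ x‖)
    (by fun_prop) hpos
  have hF0 : ∀ x, x + ψ x ≠ 0 := by
    intro x h
    have h1 := happ x
    rw [dist_eq_norm] at h1
    have h2 : ψ x - φ x = -(x + φ x) := by
      rw [eq_neg_of_add_eq_zero_right h]; abel
    rw [h2, norm_neg] at h1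
    exact lt_irrefl _ h1
  have hFid : ∀ x, r ≤ ‖x‖ → ψ x = 0 := fun x hx => by
    by_contra h
    exact hψs h (hsupp x hx)
  have hF : ContDiff ℝ 1 fun x => x + ψ x := contDiff_id.add hψ
  refine no_contDiff_retraction (R := r) hr (G := fun x => (r * ‖x + ψ x‖⁻¹) • (x + ψ x)) ?_ ?_ ?_
  · exact (contDiff_const.mul ((hF.norm ℝ hF0).inv fun x => norm_ne_zero_iff.mpr (hF0 x))).smul hF
  · intro x
    rw [norm_smul, norm_mul, norm_inv, norm_norm, Real.norm_of_nonneg hr.le, mul_assoc,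
      inv_mul_cancel₀ (norm_ne_zero_iff.mpr (hF0 x)), mul_one]
  · intro x hx
    have hx' : ‖x‖ = r := by simpa using hx
    simp [hFid x hx'.ge, hx', hr.ne']

end NoRetraction

/-! ### Vanishing of first Čech cohomology with $\mathbb Z/2$ coefficients. -/

namespace MonodromyTrivial

open Set Metric Filter Topology NoRetraction

universe u u' w

theorem continuousOn_add_zmod {X : Type*} [TopologicalSpace X] {f g : X → ZMod 2} {s : Set X}
    (hf : ContinuousOn f s) (hg : ContinuousOn g s) : ContinuousOn (fun x => f x + g x) s :=
  (continuous_of_discreteTopology (f := fun p : ZMod 2 × ZMod 2 => p.1 + p.2)).comp_continuousOn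
    (hf.prodMk hg)

/-- Every locally constant `ZMod 2`-cocycle on a cover of `s` by open sets is a coboundary. -/
def CocyclesSplit {X : Type u} [TopologicalSpace X] (s : Set X) : Prop :=
  ∀ (ι : Type w) (U : ι → Set X) (g : ι → ι → X → ZMod 2), (∀ i, IsOpen (U i)) →
    (∀ x ∈ s, ∃ i, x ∈ U i) → (∀ i j, ContinuousOn (g i j) (s ∩ (U i ∩ U j))) →
    (∀ i j k, ∀ x ∈ s, x ∈ U i → x ∈ U j → x ∈ U k → g i j x + g j k x = g i k x) →
    ∃ f : ι → X → ZMod 2, (∀ i, ContinuousOn (f i) (s ∩ U i)) ∧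
      ∀ i j, ∀ x ∈ s, x ∈ U i → x ∈ U j → g i j x = f i x + f j x

/-- The cocycle glues a double cover of `s`. Simple connectedness lifts the identity to a global
section, and its coordinates in the local trivialisations are the splitting. -/
theorem cocyclesSplit_of_simplyConnected {X : Type u} [TopologicalSpace X] {s : Set X}
    [SimplyConnectedSpace s] [LocallyPathConnectedSpace s] : CocyclesSplit.{u, w} s := by
  intro ι U g hU hcov hg hcoc
  choose idx hidx using fun x : s => hcov x x.2
  let Z : FiberBundleCore ι s (ZMod 2) :=
    { baseSet := fun i => Subtype.val ⁻¹' U i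
      isOpen_baseSet := fun i => (hU i).preimage continuous_subtype_val
      indexAt := idx
      mem_baseSet_at := hidx
      coordChange := fun i j x v => v + g i j x
      coordChange_self := fun i x hx v => by
        have := hcoc i i i x x.2 hx hx hx
        rw [add_eq_left] at this
        rw [this, add_zero]
      continuousOn_coordChange := fun i j => by
        refine continuousOn_add_zmod continuousOn_snd ?_
        have h1 : ContinuousOn (fun x : s => g i j x)
            (Subtype.val ⁻¹' U i ∩ Subtype.val ⁻¹' U j) :=
          (hg i j).comp continuous_subtype_val.continuousOn fun x hx => ⟨x.2, hx⟩
        exact h1.comp continuousOn_fst fun p hp => hp.1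
      coordChange_comp := fun i j k x hx v => by
        rw [add_assoc, hcoc i j k x x.2 hx.1.1 hx.1.2 hx.2] }
  have hcovm : IsCoveringMap (Bundle.TotalSpace.proj : Bundle.TotalSpace (ZMod 2) Z.Fiber → s) :=
    FiberBundle.isCoveringMap
  obtain ⟨x₀⟩ : Nonempty s := inferInstance
  obtain ⟨F, ⟨-, hF⟩, -⟩ := hcovm.existsUnique_continuousMap_lifts (ContinuousMap.id s) x₀
    ⟨x₀, (0 : ZMod 2)⟩ rfl
  have hproj : ∀ x, (F x).proj = x := fun x => congrFun hF x
  classical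
  let f : ι → X → ZMod 2 := fun i x => if h : x ∈ s then (Z.localTriv i (F ⟨x, h⟩)).2 else 0
  have hfx : ∀ i (x : s), f i x = (Z.localTriv i (F x)).2 := fun i x => by simp [f]
  refine ⟨f, fun i => ?_, fun i j x hx hi hj => ?_⟩
  · have h1 : ContinuousOn (fun x : s => (Z.localTriv i (F x)).2) (Subtype.val ⁻¹' U i) := by
      refine continuous_snd.comp_continuousOn ?_
      refine (Z.localTriv i).continuousOn.comp F.continuous.continuousOn fun x hx => ?_
      rw [FiberBundleCore.mem_localTriv_source, hproj]
      exact hx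
    have h2 : ContinuousOn (fun x : s => f i x) (Subtype.val ⁻¹' U i) :=
      h1.congr fun x _ => hfx i x
    rintro x ⟨hx, hxi⟩
    have h3 := h2 ⟨x, hx⟩ hxi
    rw [ContinuousWithinAt] at h3 ⊢
    have h4 : map (Subtype.val : s → X) (𝓝[Subtype.val ⁻¹' U i] ⟨x, hx⟩) = 𝓝[s ∩ U i] x := by
      rw [IsEmbedding.subtypeVal.map_nhdsWithin_eq, Subtype.image_preimage_coe]
    rw [← h4]
    exact h3
  · have h1 : ∀ k, x ∈ U k → f k x = (show ZMod 2 from (F ⟨x, hx⟩).snd) + g (idx ⟨x, hx⟩) k x := by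
      intro k hk
      rw [hfx k ⟨x, hx⟩]
      have h2 := hproj ⟨x, hx⟩
      generalize F ⟨x, hx⟩ = p at h2
      obtain ⟨b, v⟩ := p
      subst h2
      rfl
    rw [h1 i hi, h1 j hj]
    have h2 := hcoc (idx ⟨x, hx⟩) i j x hx (hidx ⟨x, hx⟩) hi hj
    rw [← h2]
    have h3 : ∀ a b c : ZMod 2, c = a + b + (a + (b + c)) := by decide
    exact h3 _ _ _

/-- On the overlap the two splittings differ by a locally constant function that does not depend on
the index. By preconnectedness it is a constant `c`, and adding `c` to the second splitting makes
the two agree: this is the relevant piece of Mayer–Vietoris. -/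
theorem CocyclesSplit.union {X : Type u} [TopologicalSpace X] {s t : Set X}
    (hs : CocyclesSplit.{u, w} s) (ht : CocyclesSplit.{u, w} t) (hso : IsOpen s) (hto : IsOpen t)
    (hst : IsPreconnected (s ∩ t)) : CocyclesSplit.{u, w} (s ∪ t) := by
  classical
  intro ι U g hU hcov hg hcoc
  obtain ⟨f₁, hc₁, h₁⟩ := hs ι U g hU (fun x hx => hcov x (.inl hx))
    (fun i j => (hg i j).mono fun x hx => ⟨.inl hx.1, hx.2⟩)
    (fun i j k x hx => hcoc i j k x (.inl hx))
  obtain ⟨f₂, hc₂, h₂⟩ := ht ι U g hU (fun x hx => hcov x (.inr hx))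
    (fun i j => (hg i j).mono fun x hx => ⟨.inr hx.1, hx.2⟩)
    (fun i j k x hx => hcoc i j k x (.inr hx))
  have hz : ∀ a b c d : ZMod 2, a + b = c + d → a + c = b + d := by decide
  obtain ⟨c, hc⟩ : ∃ c : ZMod 2, ∀ i, ∀ x ∈ s ∩ t, x ∈ U i → f₁ i x = f₂ i x + c := by
    rcases (s ∩ t).eq_empty_or_nonempty with he | ⟨x₀, hx₀⟩
    · exact ⟨0, fun i x hx => by simp [he] at hx⟩
    have : Nonempty ι := ⟨(hcov x₀ (.inl hx₀.1)).choose⟩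
    choose! idx hidx using fun x (hx : x ∈ s ∪ t) => hcov x hx
    have heq : ∀ i, ∀ x ∈ s ∩ t, x ∈ U i →
        f₁ (idx x) x + f₂ (idx x) x = f₁ i x + f₂ i x := fun i x hx hi => by
      have hi' := hidx x (.inl hx.1)
      have e₁ := h₁ _ i x hx.1 hi' hi
      have e₂ := h₂ _ i x hx.2 hi' hi
      exact hz _ _ _ _ (e₁.symm.trans e₂)
    have hcont : ContinuousOn (fun x => f₁ (idx x) x + f₂ (idx x) x) (s ∩ t) := by
      intro x hx
      have hi' := hidx x (.inl hx.1)
      have h3 : ContinuousWithinAt (fun y => f₁ (idx x) y + f₂ (idx x) y)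
          (s ∩ t ∩ U (idx x)) x :=
        continuousOn_add_zmod ((hc₁ (idx x)).mono fun y hy => ⟨hy.1.1, hy.2⟩)
          ((hc₂ (idx x)).mono fun y hy => ⟨hy.1.2, hy.2⟩) x ⟨hx, hi'⟩
      have h4 := h3.congr (g := fun y => f₁ (idx y) y + f₂ (idx y) y)
        (fun y hy => heq (idx x) y hy.1 hy.2) rfl
      exact (continuousWithinAt_inter ((hU _).mem_nhds hi')).mp h4
    refine ⟨f₁ (idx x₀) x₀ + f₂ (idx x₀) x₀, fun i x hx hi => ?_⟩
    have h5 := hst.constant hcont hx hx₀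
    rw [← h5]
    rw [heq i x hx hi]
    generalize f₁ i x = a
    generalize f₂ i x = b
    revert a b
    decide
  have hfs : ∀ i, ∀ x ∈ s, (if x ∈ s then f₁ i x else f₂ i x + c) = f₁ i x :=
    fun i x hx => if_pos hx
  have hft : ∀ i, ∀ x ∈ t, x ∈ U i → (if x ∈ s then f₁ i x else f₂ i x + c) = f₂ i x + c := by
    intro i x hx hi
    by_cases h : x ∈ s
    · rw [if_pos h, hc i x ⟨h, hx⟩ hi]
    · rw [if_neg h]
  refine ⟨fun i x => if x ∈ s then f₁ i x else f₂ i x + c, fun i => ?_, fun i j x hx hi hj => ?_⟩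
  · rintro x ⟨hx | hx, hi⟩
    · have h3 := ((hc₁ i).congr fun y hy => hfs i y hy.1) x ⟨hx, hi⟩
      rw [inter_comm] at h3
      have h4 := (continuousWithinAt_inter (hso.mem_nhds hx)).mp h3
      exact h4.mono inter_subset_right
    · have h3 := ((continuousOn_add_zmod (hc₂ i) (continuousOn_const (c := c))).congr
        fun y hy => hft i y hy.1 hy.2) x ⟨hx, hi⟩
      rw [inter_comm] at h3
      have h4 := (continuousWithinAt_inter (hto.mem_nhds hx)).mp h3
      exact h4.mono inter_subset_right
  · rcases hx with hx | hx
    · dsimp only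
      rw [hfs i x hx, hfs j x hx, h₁ i j x hx hi hj]
    · dsimp only
      rw [hft i x hx hi, hft j x hx hj, h₂ i j x hx hi hj]
      generalize f₂ i x = a
      generalize f₂ j x = b
      clear hfs hft hc
      revert a b c
      decide

theorem CocyclesSplit.image {X : Type u} {Y : Type u'} [TopologicalSpace X] [TopologicalSpace Y] [Nonempty X]
    {e : X → Y} (he : IsOpenEmbedding e) {s : Set X} (hs : CocyclesSplit.{u, w} s) :
    CocyclesSplit.{u', w} (e '' s) := by
  intro ι U g hU hcov hg hcoc
  obtain ⟨f, hf, hfg⟩ := hs ι (fun i => e ⁻¹' U i) (fun i j x => g i j (e x))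
    (fun i => (hU i).preimage he.continuous) (fun x hx => hcov (e x) ⟨x, hx, rfl⟩)
    (fun i j => (hg i j).comp he.continuous.continuousOn
      fun x hx => ⟨⟨x, hx.1, rfl⟩, hx.2⟩)
    (fun i j k x hx => hcoc i j k (e x) ⟨x, hx, rfl⟩)
  let φ := he.toOpenPartialHomeomorph
  have hφ : ∀ x, φ.symm (e x) = x := fun x => φ.left_inv (x := x) (by simp [φ])
  refine ⟨fun i y => f i (φ.symm y), fun i => ?_, ?_⟩
  · refine (hf i).comp (φ.continuousOn_symm.mono ?_) ?_
    · rintro _ ⟨⟨x, -, rfl⟩, -⟩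
      simp [φ]
    · rintro _ ⟨⟨x, hx, rfl⟩, hi⟩
      rw [hφ]
      exact ⟨hx, hi⟩
  · rintro i j _ ⟨x, hx, rfl⟩ hi hj
    dsimp only
    rw [hφ]
    exact hfg i j x hx hi hj

theorem cocyclesSplit_of_starConvex {s : Set E3} {x : E3} (hx : x ∈ s) (hs : StarConvex ℝ x s)
    (ho : IsOpen s) : CocyclesSplit.{0, w} s := by
  have := hs.contractibleSpace ⟨x, hx⟩
  have : LocallyPathConnectedSpace s := ho.locallyPathConnectedSpace
  exact cocyclesSplit_of_simplyConnected

theorem cocyclesSplit_univ : CocyclesSplit.{0, w} (univ : Set E3) :=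
  cocyclesSplit_of_starConvex (mem_univ 0) (starConvex_univ 0) isOpen_univ

theorem isOpen_slit (r c : ℝ) :
    IsOpen {x : E3 | x ∈ ball 0 r ∧ (x 1 ≠ 0 ∨ x 2 ≠ 0 ∨ x 0 * c < 0)} := by
  have h1 : IsOpen {x : E3 | x 1 ≠ 0} := isOpen_ne_fun (by fun_prop) continuous_const
  have h2 : IsOpen {x : E3 | x 2 ≠ 0} := isOpen_ne_fun (by fun_prop) continuous_const
  have h3 : IsOpen {x : E3 | x 0 * c < 0} := isOpen_lt (by fun_prop) continuous_const
  exact isOpen_ball.inter (h1.union (h2.union h3))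

/-- Deleting from the ball the closed half of the first axis on which $x_0c\ge 0$ leaves a set that
is star-shaped about the point of the other half-axis at distance $r/2$ from the origin. -/
theorem cocyclesSplit_slit {r : ℝ} (hr : 0 < r) {c : ℝ} (hc : c ≠ 0) :
    CocyclesSplit.{0, w} {x : E3 | x ∈ ball 0 r ∧ (x 1 ≠ 0 ∨ x 2 ≠ 0 ∨ x 0 * c < 0)} := by
  have hc2 : 0 < c * c := mul_self_pos.mpr hc
  set p : E3 := EuclideanSpace.single 0 (-(r / (2 * |c|)) * c) with hp
  have hp0 : p 0 = -(r / (2 * |c|)) * c := by simp [hp]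
  have hp1 : p 1 = 0 := by simp [hp]
  have hp2 : p 2 = 0 := by simp [hp]
  have hac : 0 < |c| := abs_pos.mpr hc
  have hpc : p 0 * c < 0 := by
    rw [hp0, mul_assoc, neg_mul, neg_lt_zero]
    positivity
  refine cocyclesSplit_of_starConvex (x := p) ⟨?_, .inr (.inr hpc)⟩ ?_ ?_
  · rw [mem_ball_zero_iff, hp, PiLp.norm_single, Real.norm_eq_abs, abs_mul, abs_neg,
      abs_of_pos (by positivity)]
    field_simp
    linarith
  · have hpb : p ∈ ball (0 : E3) r := by
      rw [mem_ball_zero_iff, hp, PiLp.norm_single, Real.norm_eq_abs, abs_mul, abs_neg,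
        abs_of_pos (by positivity)]
      field_simp
      linarith
    intro y hy a b ha hb hab
    refine ⟨convex_ball (0 : E3) r hpb hy.1 ha hb hab, ?_⟩
    simp only [PiLp.add_apply, PiLp.smul_apply, smul_eq_mul, hp1, hp2, mul_zero, zero_add]
    rcases hb.eq_or_lt with rfl | hb
    · right; right
      have : a = 1 := by linarith
      simpa [this] using hpc
    rcases hy.2 with h | h | h
    · exact .inl (mul_ne_zero hb.ne' h)
    · exact .inr (.inl (mul_ne_zero hb.ne' h))
    · right; right
      nlinarith
  · exact isOpen_slit r _

/-- Four open half-balls cover the set, and consecutive ones overlap. -/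
theorem isPreconnected_ball_sdiff_axis {r : ℝ} (hr : 0 < r) :
    IsPreconnected {x : E3 | x ∈ ball 0 r ∧ (x 1 ≠ 0 ∨ x 2 ≠ 0)} := by
  have half : ∀ (i : Fin 3) (c : ℝ), Convex ℝ {x : E3 | x ∈ ball 0 r ∧ 0 < c * x i} := by
    intro i c x hx y hy a b ha hb hab
    refine ⟨convex_ball (0 : E3) r hx.1 hy.1 ha hb hab, ?_⟩
    have h1 := hx.2
    have h2 := hy.2
    simp only [PiLp.add_apply, PiLp.smul_apply, smul_eq_mul]
    rcases ha.eq_or_lt with rfl | ha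
    · have : b = 1 := by linarith
      subst this
      simpa using h2
    · nlinarith [mul_pos ha h1, mul_nonneg hb h2.le]
  have pt : ∀ a b : ℝ, |a| = 1 → |b| = 1 →
      ∃ x : E3, x ∈ ball (0 : E3) r ∧ x 1 = r / 4 * a ∧ x 2 = r / 4 * b := by
    intro a b ha hb
    refine ⟨EuclideanSpace.single 1 (r / 4 * a) + EuclideanSpace.single 2 (r / 4 * b), ?_, ?_, ?_⟩
    · rw [mem_ball_zero_iff]
      refine (norm_add_le _ _).trans_lt ?_
      rw [PiLp.norm_single, PiLp.norm_single, Real.norm_eq_abs,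
        Real.norm_eq_abs, abs_mul, abs_mul, ha, hb, abs_of_pos (by positivity)]
      linarith
    · simp
    · simp
  have h1 := (half 1 1).isPreconnected
  have h2 := (half 2 1).isPreconnected
  have h3 := (half 1 (-1)).isPreconnected
  have h4 := (half 2 (-1)).isPreconnected
  obtain ⟨x, hx, hx1, hx2⟩ := pt 1 1 (by simp) (by simp)
  obtain ⟨y, hy, hy1, hy2⟩ := pt (-1) 1 (by simp) (by simp)
  obtain ⟨z, hz, hz1, hz2⟩ := pt (-1) (-1) (by simp) (by simp)
  have u1 := h1.union x (by simp_all) (by simp_all) h2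
  have u2 := u1.union y (.inr (by simp_all)) (by simp_all) h3
  have u3 := u2.union z (.inr (by simp_all)) (by simp_all) h4
  convert u3 using 1
  ext v
  simp only [mem_ofPred_eq, mem_union, one_mul, neg_mul, ne_iff_lt_or_gt, neg_pos]
  tauto

/-- Two balls slit along opposite half-axes cover the punctured ball, and they overlap in the ball
without its axis, which is connected. -/
theorem cocyclesSplit_punctured_ball {r : ℝ} (hr : 0 < r) :
    CocyclesSplit.{0, w} (ball (0 : E3) r \ {0}) := by
  have h := (cocyclesSplit_slit.{w} hr (c := 1) one_ne_zero).union
    (cocyclesSplit_slit.{w} hr (c := -1) (by simp)) ?_ ?_ ?_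
  · convert h using 1
    ext v
    have hv : v = 0 ↔ v 0 = 0 ∧ v 1 = 0 ∧ v 2 = 0 := by
      constructor
      · rintro rfl; simp
      · rintro ⟨h0, h1, h2⟩
        ext i
        fin_cases i <;> simpa
    simp only [Set.mem_sdiff, mem_singleton_iff, hv, mem_union, mem_ofPred_eq, mul_one, mul_neg,
      neg_lt_zero]
    rcases lt_trichotomy (v 0) 0 with h | h | h
    · simp [h, h.ne, h.not_gt]
      tauto
    · simp only [h, lt_irrefl, or_false, true_and]
      tauto
    · simp [h, h.ne', h.not_gt]
      tauto
  · exact isOpen_slit r _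
  · exact isOpen_slit r _
  · convert isPreconnected_ball_sdiff_axis hr using 1
    ext v
    simp only [mem_inter_iff, mem_ofPred_eq, mul_one, mul_neg, neg_lt_zero]
    have := fun h : v 0 < 0 => not_lt.mpr h.le
    tauto

end MonodromyTrivial

/-! ### Charts of the 3-sphere and its simplicial 1-cocycles. -/

namespace SphereTopology

open Set Metric Filter Topology NoRetraction MonodromyTrivial

universe u w

/-- Stereographic projection from `q`, translated so that `p` sits at the origin. -/
theorem exists_chart {X : Type u} [TopologicalSpace X]
    (φ : X ≃ₜ sphere (0 : EuclideanSpace ℝ (Fin 4)) 1) {p q : X} (hpq : p ≠ q) :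
    ∃ e : E3 → X, IsOpenEmbedding e ∧ range e = {q}ᶜ ∧ e 0 = p := by
  have : Fact (Module.finrank ℝ (EuclideanSpace ℝ (Fin 4)) = 3 + 1) := ⟨by simp⟩
  let st := stereographic' 3 (φ q)
  have hsrc : st.source = {φ q}ᶜ := stereographic'_source (φ q)
  have htgt : st.target = univ := stereographic'_target (φ q)
  have hst : IsOpenEmbedding st.symm := st.symm.isOpenEmbedding htgt
  have hp : φ p ∈ st.source := by
    rw [hsrc]
    exact fun h => hpq (φ.injective h)
  refine ⟨fun y => φ.symm (st.symm (y + st (φ p))), ?_, ?_, ?_⟩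
  · exact φ.symm.isOpenEmbedding.comp (hst.comp (Homeomorph.addRight (st (φ p))).isOpenEmbedding)
  · ext x
    constructor
    · rintro ⟨y, rfl⟩ h
      have h1 : st.symm (y + st (φ p)) ∈ st.source := st.map_target (by simp [htgt])
      rw [hsrc] at h1
      apply h1
      have h2 : φ.symm (st.symm (y + st (φ p))) = q := h
      rw [mem_singleton_iff, ← h2, φ.apply_symm_apply]
    · intro hx
      have h1 : φ x ∈ st.source := by
        rw [hsrc]
        exact fun h => hx (φ.injective h)
      refine ⟨st (φ x) - st (φ p), ?_⟩
      simp [st.left_inv h1]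
  · simp [st.left_inv hp]

theorem isPreconnected_compl_finite {X : Type u} [TopologicalSpace X]
    (φ : X ≃ₜ sphere (0 : EuclideanSpace ℝ (Fin 4)) 1) {F : Set X} (hF : F.Finite) (hne : F.Nonempty)
    (hne' : Fᶜ.Nonempty) : IsPreconnected Fᶜ := by
  obtain ⟨q, hq⟩ := hne
  obtain ⟨p, hp⟩ := hne'
  obtain ⟨e, he, hr, -⟩ := exists_chart φ (p := p) (q := q) (by rintro rfl; exact hp hq)
  have h1 : Fᶜ = e '' (e ⁻¹' F)ᶜ := by
    rw [← preimage_compl, image_preimage_eq_inter_range, hr, inter_eq_left.mpr]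
    exact compl_subset_compl.mpr (singleton_subset_iff.mpr hq)
  rw [h1]
  refine IsPreconnected.image ?_ e he.continuous.continuousOn
  refine (Set.Countable.isConnected_compl_of_one_lt_rank ?_ ?_).isPreconnected
  · rw [← Module.finrank_eq_rank]
    simp
  · exact (hF.preimage he.injective.injOn).countable

/-- The complements of two distinct points are charts, and their overlap, the complement of both
points, is connected. -/
theorem cocyclesSplit_sphere {X : Type u} [TopologicalSpace X]
    (φ : X ≃ₜ sphere (0 : EuclideanSpace ℝ (Fin 4)) 1) :
    CocyclesSplit.{u, w} (univ : Set X) := by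
  let a : sphere (0 : EuclideanSpace ℝ (Fin 4)) 1 := ⟨EuclideanSpace.single 0 1, by simp⟩
  let b : sphere (0 : EuclideanSpace ℝ (Fin 4)) 1 := ⟨EuclideanSpace.single 1 1, by simp⟩
  have hab : φ.symm a ≠ φ.symm b := by
    intro h
    have h1 := congrArg (fun y : EuclideanSpace ℝ (Fin 4) => y 0)
      (congrArg Subtype.val (φ.symm.injective h))
    simp [a, b] at h1
  have key : ∀ p q : X, p ≠ q → CocyclesSplit.{u, w} ({q}ᶜ : Set X) := by
    intro p q hpq
    obtain ⟨e, he, hr, -⟩ := exists_chart φ hpq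
    have := cocyclesSplit_univ.{w}.image he
    rwa [image_univ, hr] at this
  have hT1 : T1Space X := φ.symm.t1Space
  have h := (key _ _ hab).union (key _ _ hab.symm) isOpen_compl_singleton isOpen_compl_singleton ?_
  · rwa [← compl_inter, singleton_inter_eq_empty.mpr (by simpa using hab.symm), compl_empty] at h
  · rw [← compl_union]
    refine isPreconnected_compl_finite φ (by simp) (by simp) ?_
    let c : sphere (0 : EuclideanSpace ℝ (Fin 4)) 1 := ⟨EuclideanSpace.single 2 1, by simp⟩
    refine ⟨φ.symm c, ?_⟩
    rintro (h | h)
    · have h1 := congrArg (fun y : EuclideanSpace ℝ (Fin 4) => y 2)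
        (congrArg Subtype.val (φ.symm.injective h))
      simp [c, b] at h1
    · have h1 := congrArg (fun y : EuclideanSpace ℝ (Fin 4) => y 2)
        (congrArg Subtype.val (φ.symm.injective h))
      simp [c, a] at h1

section Realization

variable {V : Type u} {S : PreAbstractSimplicialComplex V}

theorem face_mono {σ τ : Finset V} (hσ : σ ∈ S.faces) (h : τ ⊆ σ) (hne : τ.Nonempty) :
    τ ∈ S.faces :=
  (S.isRelLowerSet_faces hσ).2 h hne

/-- The point of the open cone neighbourhood that divides the segment from `x` to the vertex `a`
in the ratio `t : 1 - t`. -/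
noncomputable def toward [DecidableEq V] (x : V → ℝ) (a : V) (t : ℝ) : V → ℝ :=
  fun i => (1 - t) * x i + t * (Pi.single a 1 : V → ℝ) i

theorem toward_supp [DecidableEq V] {x : V → ℝ} {σ : Finset V} (hx : ∀ i, x i ≠ 0 → i ∈ σ) {a : V}
    (ha : a ∈ σ) (t : ℝ) : ∀ i, toward x a t i ≠ 0 → i ∈ σ := by
  intro i hi
  by_cases h : i = a
  · rwa [h]
  · by_contra h2
    have h3 : x i = 0 := by
      by_contra h4
      exact h2 (hx i h4)
    simp [toward, h3, h] at hi

variable [Fintype V]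

/-- The point of the realization with barycentric coordinates `x`, supported in the face `σ`. -/
def point {σ : Finset V} (hσ : σ ∈ S.faces) (x : V → ℝ) (hx : x ∈ stdSimplex ℝ V)
    (h : ∀ i, x i ≠ 0 → i ∈ σ) : S.realization :=
  ⟨x, hx, σ, hσ, h⟩

theorem toward_mem_stdSimplex [DecidableEq V] {x : V → ℝ} (hx : x ∈ stdSimplex ℝ V) (a : V)
    {t : ℝ} (h0 : 0 ≤ t) (h1 : t ≤ 1) : toward x a t ∈ stdSimplex ℝ V :=
  convex_stdSimplex ℝ V hx (single_mem_stdSimplex ℝ a) (by linarith) h0 (by ring)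

theorem isPreconnected_segment {σ : Finset V} (hσ : σ ∈ S.faces) {x y : S.realization}
    (hx : ∀ i, x.1 i ≠ 0 → i ∈ σ) (hy : ∀ i, y.1 i ≠ 0 → i ∈ σ) :
    IsPreconnected {z : S.realization | z.1 ∈ segment ℝ x.1 y.1} := by
  rw [← IsInducing.subtypeVal.isPreconnected_image]
  have : Subtype.val '' {z : S.realization | z.1 ∈ segment ℝ x.1 y.1} = segment ℝ x.1 y.1 := by
    ext z
    constructor
    · rintro ⟨z, hz, rfl⟩
      exact hz
    · intro hz
      refine ⟨⟨z, (convex_stdSimplex ℝ V).segment_subset x.2.1 y.2.1 hz, σ, hσ, ?_⟩, hz, rfl⟩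
      obtain ⟨a, b, -, -, -, rfl⟩ := hz
      intro i hi
      by_contra h
      have h1 : x.1 i = 0 := by by_contra h2; exact h (hx i h2)
      have h2 : y.1 i = 0 := by by_contra h3; exact h (hy i h3)
      simp [h1, h2] at hi
  rw [this]
  exact (convex_segment _ _).isPreconnected

theorem continuous_coord (i : V) : Continuous fun x : S.realization => x.1 i :=
  (continuous_apply i).comp continuous_subtype_val

theorem coord_nonneg (x : S.realization) (i : V) : 0 ≤ x.1 i := x.2.1.1 i

theorem exists_coord_pos (x : S.realization) : ∃ i, 0 < x.1 i := by
  by_contra! h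
  have h1 : ∑ i, x.1 i = 1 := x.2.1.2
  have h2 : ∑ i, x.1 i = 0 := Finset.sum_eq_zero fun i _ => le_antisymm (h i) (coord_nonneg x i)
  linarith

theorem face_of_pos (x : S.realization) {τ : Finset V} (hne : τ.Nonempty)
    (h : ∀ i ∈ τ, 0 < x.1 i) : τ ∈ S.faces := by
  obtain ⟨σ, hσ, hs⟩ := x.2.2
  exact face_mono hσ (fun i hi => hs i (h i hi).ne') hne

/-- Every simplicial `1`-cocycle with coefficients in `ZMod 2` of a triangulated three-sphere is a
coboundary. -/
theorem exists_coboundary [DecidableEq V]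
    (φ : S.realization ≃ₜ sphere (0 : EuclideanSpace ℝ (Fin 4)) 1)
    (z : V → V → ZMod 2) (hz : ∀ a b c, {a, b, c} ∈ S.faces → z a b + z b c = z a c) :
    ∃ f : V → ZMod 2, ∀ a b, {a, b} ∈ S.faces → z a b = f a + f b := by
  classical
  -- Apply Čech vanishing to the cover by open vertex stars: stars with a common point have vertices
  -- that span a face, so the simplicial cocycle is a Čech cocycle with constant entries.
  obtain ⟨f, hf, hfz⟩ := cocyclesSplit_sphere φ V (fun a => {x | 0 < x.1 a})
    (fun a b _ => z a b) (fun a => isOpen_lt continuous_const (continuous_coord a))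
    (fun x _ => exists_coord_pos x) (fun _ _ => continuousOn_const)
    (fun a b c x _ ha hb hc => hz a b c (face_of_pos x (by simp) (by
      simp only [Finset.mem_insert, Finset.mem_singleton]
      rintro i (rfl | rfl | rfl) <;> assumption)))
  let F : V → ZMod 2 := fun a =>
    if h : {a} ∈ S.faces then f a (point h (Pi.single a 1) (single_mem_stdSimplex ℝ a)
      (fun i hi => by
        by_contra h2
        simp only [Finset.mem_singleton] at h2
        simp [h2] at hi)) else 0
  -- The open star of `a` is joined to `a` by segments, so the locally constant `f a` takes there
  -- its value at the vertex itself. Comparing the values at the midpoint of an edge then gives the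
  -- claim.
  have key : ∀ a (x : S.realization), 0 < x.1 a → f a x = F a := by
    intro a x hx
    have ha : {a} ∈ S.faces := face_of_pos x (by simp) (by simpa using hx)
    simp only [F, ha, dif_pos]
    obtain ⟨σ, hσ, hs⟩ := x.2.2
    have haσ : a ∈ σ := hs a hx.ne'
    have hsupp : ∀ i, (Pi.single a 1 : V → ℝ) i ≠ 0 → i ∈ σ := by
      intro i hi
      by_cases h : i = a
      · rwa [h]
      · simp [h] at hi
    refine (isPreconnected_segment hσ (x := x) (y := point ha (Pi.single a 1) _ _) hs
      hsupp).constant ((hf a).mono ?_) (left_mem_segment ..) (right_mem_segment ..)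
    rintro z ⟨b, c, hb, hc, hbc, h⟩
    refine ⟨mem_univ _, ?_⟩
    change 0 < z.1 a
    rw [← h]
    simp only [point, Pi.add_apply, Pi.smul_apply, Pi.single_eq_same, smul_eq_mul, mul_one]
    rcases hc.eq_or_lt with rfl | hc
    · have : b = 1 := by linarith
      simpa [this] using hx
    · have := mul_nonneg hb hx.le
      linarith
  refine ⟨F, fun a b hab => ?_⟩
  let m : S.realization := point hab (toward (Pi.single a 1) b (1 / 2))
    (toward_mem_stdSimplex (single_mem_stdSimplex ℝ a) b (by norm_num) (by norm_num))
    (toward_supp (fun i hi => by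
        by_cases h : i = a
        · simp [h]
        · simp [h] at hi) (by simp) _)
  have ha : 0 < m.1 a := by
    by_cases h : a = b
    · simp [m, point, toward, h]
    · simp only [m, point, toward, Pi.single_apply, h, if_true, if_false]
      norm_num
  have hb : 0 < m.1 b := by
    by_cases h : b = a
    · simp [m, point, toward, h]
    · simp [m, point, toward, h]
  rw [hfz a b m (mem_univ _) ha hb, key a m ha, key b m hb]

end Realization

end SphereTopology

/-! ### Local structure of a triangulated 3-sphere: triangles, edges and strong connectedness. -/

namespace SphereTopology

open Set Metric Filter Topology NoRetraction MonodromyTrivial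

universe u w

variable {V : Type u} {S : PreAbstractSimplicialComplex V}

/-- The barycentre of a nonempty finite set of vertices. -/
noncomputable def barycentre [DecidableEq V] (τ : Finset V) : V → ℝ :=
  fun i => if i ∈ τ then (τ.card : ℝ)⁻¹ else 0

theorem barycentre_supp [DecidableEq V] {τ : Finset V} (i : V) (hi : barycentre τ i ≠ 0) :
    i ∈ τ := by
  by_contra h
  simp [barycentre, h] at hi

theorem barycentre_pos [DecidableEq V] {τ : Finset V} {i : V} (hi : i ∈ τ) :
    0 < barycentre τ i := by
  have : 0 < τ.card := Finset.card_pos.mpr ⟨i, hi⟩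
  simp only [barycentre, hi, if_true]
  positivity

variable [Fintype V]

theorem barycentre_mem [DecidableEq V] {τ : Finset V} (h : τ.Nonempty) :
    barycentre τ ∈ stdSimplex ℝ V := by
  have h0 : (τ.card : ℝ) ≠ 0 := by exact_mod_cast h.card_ne_zero
  refine ⟨fun i => ?_, ?_⟩
  · unfold barycentre
    split_ifs <;> positivity
  · simp [barycentre, Finset.sum_ite_mem, h0]

/-- In a triangulated three-sphere no triangle lies in exactly one tetrahedron. -/
theorem exists_second_tetrahedron (φ : S.realization ≃ₜ sphere (0 : EuclideanSpace ℝ (Fin 4)) 1)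
    (hpure : S.IsPure 3) {τ σ : Finset V} (hσ : σ ∈ S.faces) (hσ4 : σ.card = 4) (hτσ : τ ⊆ σ)
    (hτ3 : τ.card = 3) : ∃ σ' ∈ S.faces, σ'.card = 4 ∧ τ ⊆ σ' ∧ σ' ≠ σ := by
  classical
  by_contra! hun
  have hτne : τ.Nonempty := Finset.card_pos.mp (by omega)
  have hτf : τ ∈ S.faces := face_mono hσ hτσ hτne
  obtain ⟨w, hwσ, hwτ⟩ := Finset.exists_mem_notMem_of_card_lt_card (s := τ) (t := σ) (by omega)
  obtain ⟨i₀, hi₀⟩ := hτne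
  obtain ⟨i₁, hi₁, hi₁₀⟩ := Finset.exists_mem_ne (by omega : 1 < τ.card) i₀
  let p : S.realization := point hτf (barycentre τ) (barycentre_mem ⟨i₀, hi₀⟩) barycentre_supp
  -- The point omitted by the chart is a vertex of `τ`. Its `i₁`-coordinate vanishes, whereas every
  -- point occurring below keeps this coordinate positive.
  let q : S.realization := point (face_mono hτf (Finset.singleton_subset_iff.mpr hi₀) (by simp))
    (barycentre {i₀}) (barycentre_mem (by simp)) barycentre_supp
  have hq : q.1 i₁ = 0 := by simp [q, point, barycentre, hi₁₀]
  have hpw : p.1 w = 0 := by simp [p, point, barycentre, hwτ]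
  have hpq : p ≠ q := by
    intro h
    have h1 : 0 < p.1 i₁ := barycentre_pos hi₁
    rw [h, hq] at h1
    exact lt_irrefl _ h1
  obtain ⟨e, he, hr, he0⟩ := exists_chart φ hpq
  have hW : IsOpen {y : E3 | ∀ i ∈ τ, 0 < (e y).1 i} := by
    have : {y : E3 | ∀ i ∈ τ, 0 < (e y).1 i} = ⋂ i ∈ τ, {y : E3 | 0 < (e y).1 i} := by
      ext; simp
    rw [this]
    exact isOpen_biInter_finset fun i _ =>
      isOpen_lt continuous_const ((continuous_coord i).comp he.continuous)
  obtain ⟨r, hr0, hrW⟩ := nhds_basis_closedBall.mem_iff.mp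
    (hW.mem_nhds (show (0 : E3) ∈ _ from fun i hi => by rw [he0]; exact barycentre_pos hi))
  have hsupp : ∀ y ∈ closedBall (0 : E3) r, ∀ i, (e y).1 i ≠ 0 → i ∈ σ := by
    intro y hy i hi
    obtain ⟨ρ, hρ, hs⟩ := (e y).2.2
    obtain ⟨σ', hσ', hρσ, hc⟩ := hpure ρ hρ
    have h1 : τ ⊆ σ' := fun j hj => hρσ (hs j (hrW hy j hj).ne')
    rw [← hun σ' hσ' hc h1]
    exact hρσ (hs i hi)
  -- Near the barycentre of `τ` everything lies in `σ`, so points can be pushed towards the apex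
  -- `w`. The amount vanishes on the boundary of the chart ball, is positive inside, and never
  -- exceeds 1/2. The push fixes the boundary but misses the centre, which is impossible.
  let s : E3 → ℝ := fun y => (1 - ‖y‖ / r) / 2
  have hs0 : ∀ y ∈ closedBall (0 : E3) r, 0 ≤ s y := by
    intro y hy
    have : ‖y‖ / r ≤ 1 := (div_le_one hr0).mpr (by simpa using hy)
    simp only [s]
    linarith
  have hs1 : ∀ y, s y ≤ 1 / 2 := by
    intro y
    have : 0 ≤ ‖y‖ / r := by positivity
    simp only [s]
    linarith
  let c : closedBall (0 : E3) r → S.realization := fun y =>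
    point hσ (toward (e y).1 w (s y))
      (toward_mem_stdSimplex (e y).2.1 w (hs0 y y.2) (by linarith [hs1 y]))
      (toward_supp (hsupp y y.2) hwσ _)
  have hc : Continuous c := by
    refine Continuous.subtype_mk ?_ _
    refine continuous_pi fun i => ?_
    have h1 : Continuous fun y : closedBall (0 : E3) r => s y := by
      simp only [s]
      fun_prop
    have h2 : Continuous fun y : closedBall (0 : E3) r => (e y).1 i :=
      (continuous_coord i).comp (he.continuous.comp continuous_subtype_val)
    exact ((continuous_const.sub h1).mul h2).add (h1.mul continuous_const)
  have hcq : ∀ y, c y ≠ q := by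
    intro y h
    have h1 : (c y).1 i₁ = 0 := by rw [h, hq]
    have h2 : 0 < (e y).1 i₁ := hrW y.2 i₁ hi₁
    have h3 := hs1 y
    have h4 : i₁ ≠ w := by rintro rfl; exact hwτ hi₁
    simp only [c, point, toward, Pi.single_apply, h4, if_false] at h1
    nlinarith
  choose f hf using fun y => (show c y ∈ range e by rw [hr]; exact hcq y)
  have hfc : Continuous f := by
    rw [he.isInducing.continuous_iff]
    exact hc.congr fun y => (hf y).symm
  let g : E3 → E3 := fun y => if h : y ∈ closedBall 0 r then f ⟨y, h⟩ else 0
  have hg : ∀ y : closedBall (0 : E3) r, g y = f y := fun y => dif_pos y.2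
  have hsph : ∀ y : closedBall (0 : E3) r, ‖y.1‖ = r → f y = y := by
    intro y hy
    apply he.injective
    rw [hf]
    have : s y = 0 := by simp [s, hy, hr0.ne']
    apply Subtype.ext
    funext i
    simp [c, point, toward, this]
  obtain ⟨y, hy, hy0⟩ := exists_zero_of_eq_id_on_sphere hr0 (f := g) (by
      rw [continuousOn_iff_continuous_domRestrict]
      exact hfc.congr fun y => (hg y).symm) (by
      intro x hx
      rw [hg ⟨x, sphere_subset_closedBall hx⟩]
      exact hsph ⟨x, _⟩ (by simpa using hx))
  have h1 := hf ⟨y, hy⟩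
  have h2 := hg ⟨y, hy⟩
  rw [← h2, hy0, he0] at h1
  have h3 : (c ⟨y, hy⟩).1 w = 0 := by rw [← h1, hpw]
  have h4 : s y = 0 := by
    have h5 := hs0 y hy
    have h6 := hs1 y
    have h7 := coord_nonneg (e y) w
    simp only [c, point, toward, Pi.single_eq_same] at h3
    nlinarith
  have h5 : ‖y‖ = r := by
    simp only [s] at h4
    field_simp at h4
    linarith
  have h6 := hsph ⟨y, hy⟩ h5
  rw [← h2, hy0] at h6
  simp only at h6
  rw [← h6, norm_zero] at h5
  exact hr0.ne h5

/-- The union of the tetrahedra of `S` that satisfy `P`. -/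
def tetUnion (S : PreAbstractSimplicialComplex V) (P : Finset V → Prop) : Set S.realization :=
  {x | ∃ σ ∈ S.faces, σ.card = 4 ∧ P σ ∧ ∀ i, x.1 i ≠ 0 → i ∈ σ}

theorem isClosed_tetUnion (P : Finset V → Prop) : IsClosed (tetUnion S P) := by
  classical
  have : tetUnion S P = ⋃ σ ∈ {σ : Finset V | σ ∈ S.faces ∧ σ.card = 4 ∧ P σ},
      ⋂ i ∈ {i : V | i ∉ σ}, {x : S.realization | x.1 i = 0} := by
    ext x
    simp only [tetUnion, mem_ofPred_eq, mem_iUnion, mem_iInter, exists_prop]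
    constructor
    · rintro ⟨σ, h1, h2, h3, h4⟩
      exact ⟨σ, ⟨h1, h2, h3⟩, fun i hi => by by_contra h; exact hi (h4 i h)⟩
    · rintro ⟨σ, ⟨h1, h2, h3⟩, h4⟩
      exact ⟨σ, h1, h2, h3, fun i hi => by by_contra h; exact hi (h4 i h)⟩
  rw [this]
  refine Set.Finite.isClosed_biUnion (toFinite _) fun σ _ => ?_
  exact isClosed_biInter fun i _ => isClosed_eq (continuous_coord i) continuous_const

theorem mem_tetUnion_or (hpure : S.IsPure 3) (P : Finset V → Prop) (x : S.realization) :
    x ∈ tetUnion S P ∨ x ∈ tetUnion S (fun σ => ¬ P σ) := by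
  obtain ⟨ρ, hρ, hs⟩ := x.2.2
  obtain ⟨σ, hσ, hρσ, hc⟩ := hpure ρ hρ
  by_cases h : P σ
  · exact .inl ⟨σ, hσ, hc, h, fun i hi => hρσ (hs i hi)⟩
  · exact .inr ⟨σ, hσ, hc, h, fun i hi => hρσ (hs i hi)⟩

/-- If the tetrahedra of a triangulated three-sphere are split into two classes without a common
triangle, then the classes have no common edge either. -/
theorem no_common_edge (φ : S.realization ≃ₜ sphere (0 : EuclideanSpace ℝ (Fin 4)) 1)
    (hpure : S.IsPure 3) (P : Finset V → Prop)
    (hno : ∀ σ ∈ S.faces, ∀ σ' ∈ S.faces, σ.card = 4 → σ'.card = 4 → P σ → ¬ P σ' →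
      ∀ τ, τ ⊆ σ → τ ⊆ σ' → τ.card ≤ 2)
    {σ₁ σ₂ : Finset V} (h₁ : σ₁ ∈ S.faces) (h₂ : σ₂ ∈ S.faces) (hc₁ : σ₁.card = 4)
    (hc₂ : σ₂.card = 4) (hP₁ : P σ₁) (hP₂ : ¬ P σ₂) {v : Bool → V} (hv : v true ≠ v false)
    (hv₁ : ∀ b, v b ∈ σ₁) (hv₂ : ∀ b, v b ∈ σ₂) : False := by
  classical
  have hvb : ∀ b, v b ≠ v (!b) := by
    intro b; cases b
    · exact hv.symm
    · exact hv
  set ε : Finset V := {v true, v false} with hε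
  have hvε : ∀ b, v b ∈ ε := by intro b; cases b <;> simp [hε]
  have hε₁ : ε ⊆ σ₁ := by
    intro i hi
    simp only [hε, Finset.mem_insert, Finset.mem_singleton] at hi
    rcases hi with rfl | rfl <;> apply hv₁
  have hε₂ : ε ⊆ σ₂ := by
    intro i hi
    simp only [hε, Finset.mem_insert, Finset.mem_singleton] at hi
    rcases hi with rfl | rfl <;> apply hv₂
  have hεf : ε ∈ S.faces := face_mono h₁ hε₁ ⟨_, hvε true⟩
  have hεc : ε.card = 2 := Finset.card_pair hv
  let p : S.realization := point hεf (barycentre ε) (barycentre_mem ⟨_, hvε true⟩) barycentre_supp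
  let q : S.realization :=
    point (face_mono hεf (Finset.singleton_subset_iff.mpr (hvε true)) (by simp))
    (barycentre {v true}) (barycentre_mem (by simp)) barycentre_supp
  have hpv : ∀ b, p.1 (v b) = 1 / 2 := by
    intro b
    simp [p, point, barycentre, hvε, hεc]
  have hp0 : ∀ i, i ∉ ε → p.1 i = 0 := by
    intro i hi
    simp [p, point, barycentre, hi]
  have hpq : p ≠ q := by
    intro h
    have h1 := hpv false
    rw [h] at h1
    simp [q, point, barycentre, hv.symm] at h1
  obtain ⟨e, he, hr, he0⟩ := exists_chart φ hpq
  have hW : IsOpen {y : E3 | ∀ b, 0 < (e y).1 (v b)} := by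
    have : {y : E3 | ∀ b, 0 < (e y).1 (v b)} = ⋂ b, {y : E3 | 0 < (e y).1 (v b)} := by
      ext; simp
    rw [this]
    exact isOpen_iInter_of_finite fun b =>
      isOpen_lt continuous_const ((continuous_coord _).comp he.continuous)
  obtain ⟨r, hr0, hrW⟩ := nhds_basis_ball.mem_iff.mp
    (hW.mem_nhds (show (0 : E3) ∈ _ from fun b => by rw [he0, hpv]; norm_num))
  -- The two closed halves of the edge: `H b` is the half farther from `v b`. They meet only in the
  -- barycentre, so their complements cover the punctured ball.
  let H : Bool → Set S.realization := fun b => {x | (∀ i, i ∉ ε → x.1 i = 0) ∧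
    x.1 (v b) ≤ x.1 (v (!b))}
  have hHc : ∀ b, IsClosed (H b) := by
    intro b
    have : H b = (⋂ i ∈ {i : V | i ∉ ε}, {x : S.realization | x.1 i = 0}) ∩
        {x | x.1 (v b) ≤ x.1 (v (!b))} := by
      ext x
      simp only [H, mem_ofPred_eq, mem_inter_iff, mem_iInter]
    rw [this]
    exact (isClosed_biInter fun i _ => isClosed_eq (continuous_coord i) continuous_const).inter
      (isClosed_le (continuous_coord _) (continuous_coord _))
  have hHp : ∀ x, (∀ b, x ∈ H b) → x = p := by
    intro x hx
    have h1 : x.1 (v true) = x.1 (v false) := le_antisymm (hx true).2 (hx false).2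
    have h2 : x.1 (v true) + x.1 (v false) = 1 := by
      have h3 : ∑ i, x.1 i = 1 := x.2.1.2
      rw [← Finset.sum_subset (Finset.subset_univ ε) (fun i _ hi => (hx true).1 i hi), hε,
        Finset.sum_pair hv] at h3
      exact h3
    apply Subtype.ext
    funext i
    by_cases hi : i ∈ ε
    · have h3 : i = v true ∨ i = v false := by simpa [hε] using hi
      rcases h3 with rfl | rfl
      · rw [hpv]; linarith
      · rw [hpv]; linarith
    · rw [hp0 i hi, (hx true).1 i hi]
  have hcommon : ∀ x, (∀ b, 0 < x.1 (v b)) → x ∈ tetUnion S P →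
      x ∈ tetUnion S (fun σ => ¬ P σ) → ∃ b, x ∈ H b := by
    rintro x hx ⟨σ, hσ, hc, hP, hs⟩ ⟨σ', hσ', hc', hP', hs'⟩
    have h1 := hno σ hσ σ' hσ' hc hc' hP hP' (σ ∩ σ') Finset.inter_subset_left
      Finset.inter_subset_right
    have h2 : ε ⊆ σ ∩ σ' := by
      intro i hi
      have h3 : i = v true ∨ i = v false := by simpa [hε] using hi
      have h4 : 0 < x.1 i := by rcases h3 with rfl | rfl <;> apply hx
      exact Finset.mem_inter.mpr ⟨hs i h4.ne', hs' i h4.ne'⟩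
    have h3 : ε = σ ∩ σ' := Finset.eq_of_subset_of_card_le h2 (by omega)
    have h4 : ∀ i, i ∉ ε → x.1 i = 0 := by
      intro i hi
      by_contra h
      rw [h3] at hi
      exact hi (Finset.mem_inter.mpr ⟨hs i h, hs' i h⟩)
    rcases le_total (x.1 (v true)) (x.1 (v false)) with h | h
    · exact ⟨true, h4, h⟩
    · exact ⟨false, h4, h⟩
  -- Off the edge the two classes of tetrahedra are locally disjoint closed sets, so the indicator
  -- of the first class is locally constant there and defines a cocycle for this two-set cover.
  let g : Bool → Bool → E3 → ZMod 2 := fun i j y =>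
    if i = j then 0 else if e y ∈ tetUnion S P then 1 else 0
  obtain ⟨f, hf, hfg⟩ := cocyclesSplit_punctured_ball.{0} hr0 Bool (fun b => {y | e y ∉ H b}) g
    (fun b => ((hHc b).preimage he.continuous).isOpen_compl) (by
      rintro y ⟨-, hy⟩
      by_contra! h
      apply hy
      have := hHp (e y) (fun b => by simpa using h b)
      rw [← he0] at this
      exact he.injective this) (by
      have hB : ∀ i j b : Bool, ¬ i = j → b = i ∨ b = j := by decide
      intro i j
      rintro y ⟨⟨hyb, -⟩, hyi, hyj⟩
      apply ContinuousAt.continuousWithinAt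
      by_cases hij : i = j
      · simp only [g, hij, if_true]
        exact continuousAt_const
      simp only [g, hij, if_false]
      have hnot : ∀ b, e y ∉ H b := by
        intro b
        rcases hB i j b hij with rfl | rfl <;> assumption
      by_cases hyP : e y ∈ tetUnion S P
      · have h1 : e y ∉ tetUnion S (fun σ => ¬ P σ) := fun h => by
          obtain ⟨b, hb⟩ := hcommon _ (hrW hyb) hyP h
          exact hnot b hb
        have h2 : ∀ᶠ y' in 𝓝 y, e y' ∉ tetUnion S (fun σ => ¬ P σ) :=
          (((isClosed_tetUnion _).preimage he.continuous).isOpen_compl).mem_nhds h1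
        refine (continuousAt_const (y := (1 : ZMod 2))).congr (h2.mono fun y' hy' => ?_)
        dsimp only
        rw [if_pos ((mem_tetUnion_or hpure P (e y')).resolve_right hy')]
      · have h2 : ∀ᶠ y' in 𝓝 y, e y' ∉ tetUnion S P :=
          (((isClosed_tetUnion _).preimage he.continuous).isOpen_compl).mem_nhds hyP
        refine (continuousAt_const (y := (0 : ZMod 2))).congr (h2.mono fun y' hy' => ?_)
        dsimp only
        rw [if_neg hy']) (by
      have hco : ∀ (i j k : Bool) (c : ZMod 2), ((if i = j then 0 else c) +
          if j = k then 0 else c) = if i = k then 0 else c := by decide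
      exact fun i j k y _ _ _ _ => hco i j k _)
  have hopen : IsOpen (e '' ball 0 r) := he.isOpenMap _ isOpen_ball
  obtain ⟨δ, hδ, hδb⟩ := Metric.isOpen_iff.mp hopen p ⟨0, by simpa using hr0, he0⟩
  obtain ⟨η, hη0, hη1, hηδ⟩ : ∃ η : ℝ, 0 < η ∧ η ≤ 1 / 2 ∧ η < δ :=
    ⟨min (δ / 2) (1 / 2), by positivity, min_le_right _ _,
      (min_le_left _ _).trans_lt (by linarith)⟩
  have hnear : ∀ a, toward p.1 a η ∈ ball p.1 δ := by
    intro a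
    rw [mem_ball, dist_eq_norm]
    refine lt_of_le_of_lt ?_ hηδ
    rw [pi_norm_le_iff_of_nonneg hη0.le]
    intro i
    have h1 : (toward p.1 a η - p.1) i = η * ((Pi.single a 1 : V → ℝ) i - p.1 i) := by
      simp only [Pi.sub_apply, toward]; ring
    rw [h1, norm_mul, Real.norm_of_nonneg hη0.le]
    have h2 : ‖(Pi.single a 1 : V → ℝ) i - p.1 i‖ ≤ 1 := by
      have h3 := coord_nonneg p i
      have h4 : p.1 i ≤ 1 := by
        by_cases hi : i ∈ ε
        · have h3 : i = v true ∨ i = v false := by simpa [hε] using hi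
          rcases h3 with rfl | rfl <;> rw [hpv] <;> norm_num
        · rw [hp0 i hi]; norm_num
      rw [Real.norm_eq_abs, abs_le, Pi.single_apply]
      split_ifs <;> constructor <;> linarith
    nlinarith
  have hpsupp : ∀ {σ : Finset V}, ε ⊆ σ → ∀ i, p.1 i ≠ 0 → i ∈ σ := by
    intro σ h i hi
    by_contra h'
    exact hi (hp0 i fun h2 => h' (h h2))
  let A : ∀ (σ : Finset V) (_ : σ ∈ S.faces) (_ : ε ⊆ σ) (a : V) (_ : a ∈ σ), S.realization :=
    fun σ hσ hεσ a ha => point hσ (toward p.1 a η)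
      (toward_mem_stdSimplex p.2.1 a hη0.le (by linarith)) (toward_supp (hpsupp hεσ) ha η)
  have hA : ∀ (σ : Finset V) (hσ : σ ∈ S.faces) (hεσ : ε ⊆ σ) (a : V) (ha : a ∈ σ),
      (A σ hσ hεσ a ha).1 = toward p.1 a η := fun _ _ _ _ _ => rfl
  let φe := he.toOpenPartialHomeomorph
  have hφe : ∀ x, φe.symm (e x) = x := fun x => φe.left_inv (x := x) (by simp [φe])
  -- The segment from a point off the edge to the point of the edge displaced towards `v b` avoids
  -- `H b`, where `f b` may fail to be continuous. Hence `f b` has the same value near the edge in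
  -- every tetrahedron around it, and the cocycle cannot distinguish the two classes.
  have key : ∀ (σ : Finset V) (hσ : σ ∈ S.faces) (hεσ : ε ⊆ σ) (d : V) (hd : d ∈ σ)
      (_ : d ∉ ε) (b : Bool), f b (φe.symm (A σ hσ hεσ d hd)) =
        f b (φe.symm (A ε hεf subset_rfl (v b) (hvε b))) := by
    intro σ hσ hεσ d hd hdε b
    have hseg := isPreconnected_segment hσ (x := A σ hσ hεσ d hd)
      (y := A ε hεf subset_rfl (v b) (hvε b)) (toward_supp (hpsupp hεσ) hd η)
      (toward_supp (hpsupp hεσ) (hεσ (hvε b)) η)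
    have hz : ∀ z : S.realization, z.1 ∈ segment ℝ (A σ hσ hεσ d hd).1
        (A ε hεf subset_rfl (v b) (hvε b)).1 → ∃ y ∈ (ball (0 : E3) r \ {0}) ∩
          {y | e y ∉ H b}, e y = z := by
      intro z hzs
      have hzb : z ∈ ball p δ := (convex_ball p.1 δ).segment_subset (hnear d) (hnear (v b)) hzs
      obtain ⟨y, hyb, rfl⟩ := hδb hzb
      have hnH : e y ∉ H b := by
        rintro ⟨hz0, hzle⟩
        obtain ⟨s, t, hs, ht, hst, hzst⟩ := hzs
        have h1 := congrFun hzst d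
        have h2 := congrFun hzst (v b)
        have h3 := congrFun hzst (v !b)
        rw [hz0 d hdε] at h1
        have hdb : d ≠ v b := by rintro rfl; exact hdε (hvε b)
        have hdb' : d ≠ v (!b) := by rintro rfl; exact hdε (hvε _)
        simp only [hA, Pi.add_apply, Pi.smul_apply, smul_eq_mul, toward, hp0 d hdε,
          Pi.single_apply, hdb, hdb.symm, hdb'.symm, if_true, if_false, hpv, (hvb b).symm] at h1 h2 h3
        have hs0 : s = 0 := by
          have : s * η = 0 := by linarith
          simpa [hη0.ne'] using this
        subst hs0
        have ht1 : t = 1 := by linarith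
        subst ht1
        rw [← h2, ← h3] at hzle
        linarith
      refine ⟨y, ⟨⟨hyb, ?_⟩, hnH⟩, rfl⟩
      rintro rfl
      apply hnH
      rw [he0]
      exact ⟨hp0, by rw [hpv, hpv]⟩
    refine hseg.constant (f := fun z => f b (φe.symm z)) ?_
      (left_mem_segment ..) (right_mem_segment ..)
    refine (hf b).comp (φe.continuousOn_symm.mono ?_) ?_
    · intro z hz'
      obtain ⟨y, -, rfl⟩ := hz z hz'
      simp [φe]
    · intro z hz'
      obtain ⟨y, hy, rfl⟩ := hz z hz'
      rw [hφe]
      exact hy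
  have hend : ∀ (σ : Finset V) (hσ : σ ∈ S.faces) (hεσ : ε ⊆ σ) (d : V) (hd : d ∈ σ)
      (_ : d ∉ ε), g true false (φe.symm (A σ hσ hεσ d hd)) =
        f true (φe.symm (A σ hσ hεσ d hd)) + f false (φe.symm (A σ hσ hεσ d hd)) ∧
        e (φe.symm (A σ hσ hεσ d hd)) = A σ hσ hεσ d hd ∧ (∀ b, A σ hσ hεσ d hd ∉ H b) ∧
        ∀ b, 0 < (A σ hσ hεσ d hd).1 (v b) := by
    intro σ hσ hεσ d hd hdε
    have hzb : A σ hσ hεσ d hd ∈ ball p δ := hnear d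
    obtain ⟨y, hyb, hy⟩ := hδb hzb
    have hAd : (A σ hσ hεσ d hd).1 d ≠ 0 := by
      simp [hA, toward, hp0 d hdε, hη0.ne']
    have hnH : ∀ b, A σ hσ hεσ d hd ∉ H b := fun b hb => hAd (hb.1 d hdε)
    rw [← hy, hφe]
    refine ⟨hfg true false y ⟨hyb, ?_⟩ ?_ ?_, rfl, fun b => by rw [hy]; exact hnH b, hrW hyb⟩
    · rintro rfl
      rw [he0] at hy
      rw [← hy] at hAd
      exact hAd (hp0 d hdε)
    · rw [mem_ofPred_eq, hy]; exact hnH true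
    · rw [mem_ofPred_eq, hy]; exact hnH false
  obtain ⟨d₁, hd₁, hd₁'⟩ := Finset.exists_mem_notMem_of_card_lt_card (s := ε) (t := σ₁) (by omega)
  obtain ⟨d₂, hd₂, hd₂'⟩ := Finset.exists_mem_notMem_of_card_lt_card (s := ε) (t := σ₂) (by omega)
  obtain ⟨g₁, e₁, -, -⟩ := hend σ₁ h₁ hε₁ d₁ hd₁ hd₁'
  obtain ⟨g₂, e₂, n₂, p₂⟩ := hend σ₂ h₂ hε₂ d₂ hd₂ hd₂'
  rw [key σ₁ h₁ hε₁ d₁ hd₁ hd₁' true, key σ₁ h₁ hε₁ d₁ hd₁ hd₁' false] at g₁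
  rw [key σ₂ h₂ hε₂ d₂ hd₂ hd₂' true, key σ₂ h₂ hε₂ d₂ hd₂ hd₂' false] at g₂
  have hm₁ : A σ₁ h₁ hε₁ d₁ hd₁ ∈ tetUnion S P :=
    ⟨σ₁, h₁, hc₁, hP₁, toward_supp (hpsupp hε₁) hd₁ η⟩
  have hm₂ : A σ₂ h₂ hε₂ d₂ hd₂ ∉ tetUnion S P := by
    intro h
    obtain ⟨b, hb⟩ := hcommon _ p₂ h ⟨σ₂, h₂, hc₂, hP₂, toward_supp (hpsupp hε₂) hd₂ η⟩
    exact n₂ b hb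
  simp only [g, e₁, e₂, hm₁, hm₂, if_true, if_false, Bool.true_eq_false] at g₁ g₂
  rw [← g₁] at g₂
  exact absurd g₂ (by decide)

/-- A triangulated three-sphere is strongly connected: if its tetrahedra are split into two
nonempty classes, then some triangle lies in a tetrahedron of each class. -/
theorem exists_common_triangle (φ : S.realization ≃ₜ sphere (0 : EuclideanSpace ℝ (Fin 4)) 1)
    (hpure : S.IsPure 3) (P : Finset V → Prop)
    {σ₁ σ₂ : Finset V} (h₁ : σ₁ ∈ S.faces) (h₂ : σ₂ ∈ S.faces) (hc₁ : σ₁.card = 4)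
    (hc₂ : σ₂.card = 4) (hP₁ : P σ₁) (hP₂ : ¬ P σ₂) :
    ∃ σ ∈ S.faces, ∃ σ' ∈ S.faces, σ.card = 4 ∧ σ'.card = 4 ∧ P σ ∧ ¬ P σ' ∧
      ∃ τ, τ ⊆ σ ∧ τ ⊆ σ' ∧ τ.card = 3 := by
  classical
  by_contra! hcon
  have hno : ∀ σ ∈ S.faces, ∀ σ' ∈ S.faces, σ.card = 4 → σ'.card = 4 → P σ → ¬ P σ' →
      ∀ τ, τ ⊆ σ → τ ⊆ σ' → τ.card ≤ 2 := by
    intro σ hσ σ' hσ' hc hc' hP hP' τ hτ hτ'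
    by_contra! h
    obtain ⟨τ', hs, ht⟩ := Finset.exists_subset_card_eq (s := τ) (n := 3) (by omega)
    exact hcon σ hσ σ' hσ' hc hc' hP hP' τ' (hs.trans hτ) (hs.trans hτ') ht
  have hmeet : ∀ σ ∈ S.faces, ∀ σ' ∈ S.faces, σ.card = 4 → σ'.card = 4 → P σ → ¬ P σ' →
      ∀ a b, a ∈ σ → a ∈ σ' → b ∈ σ → b ∈ σ' → a = b := by
    intro σ hσ σ' hσ' hc hc' hP hP' a b ha ha' hb hb'
    by_contra hab
    exact no_common_edge φ hpure P hno hσ hσ' hc hc' hP hP' (v := fun i => if i then a else b)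
      (by simpa using hab) (by intro i; cases i <;> simpa) (by intro i; cases i <;> simpa)
  -- The vertices. Their complement is connected, and the two closed unions of tetrahedra cover it,
  -- so they meet in a point that is not a vertex; its support would contain a common edge.
  let F : Set S.realization := {x | ∃ a, x.1 = Pi.single a 1}
  have hF : F.Finite := by
    refine Set.Finite.of_finite_image (f := Subtype.val) ?_ Subtype.val_injective.injOn
    refine (Set.finite_range fun a : V => (Pi.single a 1 : V → ℝ)).subset ?_
    rintro _ ⟨x, ⟨a, ha⟩, rfl⟩
    exact ⟨a, ha.symm⟩
  obtain ⟨a, ha⟩ : σ₁.Nonempty := Finset.card_pos.mp (by omega)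
  have hFne : F.Nonempty := ⟨point (face_mono h₁ (Finset.singleton_subset_iff.mpr ha) (by simp))
    (Pi.single a 1) (single_mem_stdSimplex ℝ a) (fun i hi => by
      by_contra h
      simp only [Finset.mem_singleton] at h
      simp [h] at hi), a, rfl⟩
  have hbary : ∀ (σ : Finset V) (hσ : σ ∈ S.faces) (hc : σ.card = 4),
      point hσ (barycentre σ) (barycentre_mem (Finset.card_pos.mp (by omega))) barycentre_supp
        ∉ F := by
    rintro σ hσ hc ⟨b, hb⟩
    obtain ⟨c, hcσ, hcb⟩ := Finset.exists_mem_ne (by omega : 1 < σ.card) b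
    have h1 := barycentre_pos hcσ
    have h2 := congrFun hb c
    simp only [point] at h2
    rw [h2, Pi.single_eq_of_ne hcb] at h1
    exact lt_irrefl _ h1
  have hconn := isPreconnected_compl_finite φ hF hFne ⟨_, hbary σ₁ h₁ hc₁⟩
  rw [isPreconnected_closed_iff] at hconn
  obtain ⟨x, hxF, ⟨σ, hσ, hc, hP, hs⟩, ⟨σ', hσ', hc', hP', hs'⟩⟩ :=
    hconn (tetUnion S P) (tetUnion S fun σ => ¬ P σ) (isClosed_tetUnion _) (isClosed_tetUnion _)
      (fun x _ => mem_tetUnion_or hpure P x)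
      ⟨_, hbary σ₁ h₁ hc₁, σ₁, h₁, hc₁, hP₁, barycentre_supp⟩
      ⟨_, hbary σ₂ h₂ hc₂, σ₂, h₂, hc₂, hP₂, barycentre_supp⟩
  obtain ⟨a, ha⟩ := exists_coord_pos x
  have hx0 : ∀ i, i ≠ a → x.1 i = 0 := by
    intro i hi
    by_contra h
    exact hi (hmeet σ hσ σ' hσ' hc hc' hP hP' i a (hs i h) (hs' i h) (hs a ha.ne') (hs' a ha.ne'))
  apply hxF
  refine ⟨a, ?_⟩
  have h1 : ∑ i, x.1 i = 1 := x.2.1.2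
  rw [Finset.sum_eq_single a (fun i _ hi => hx0 i hi) (by simp)] at h1
  funext i
  by_cases hi : i = a
  · subst hi; simpa using h1
  · rw [hx0 i hi, Pi.single_eq_of_ne hi]

end SphereTopology

/-! ### Incidence matrices over $\mathbb Z/2$ between families of finite sets. -/

namespace FaceFamily

open Finset

universe u

variable {V : Type u} [DecidableEq V]

/-- The number of members of `F` that contain `e`. -/
def degree (F : Finset (Finset V)) (e : Finset V) : ℕ := #{t ∈ F | e ⊆ t}

/-- The incidence matrix over `ZMod 2` between two finite families of sets. -/
def incidence (A B : Finset (Finset V)) : Matrix A B (ZMod 2) :=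
  Matrix.of fun a b => if a.1 ⊆ b.1 then 1 else 0

/-- The indicator vector of a subfamily. -/
def indicator (A Z : Finset (Finset V)) : A → ZMod 2 := fun a => if a.1 ∈ Z then 1 else 0

theorem degree_sdiff {F N : Finset (Finset V)} (h : N ⊆ F) (e : Finset V) :
    degree (F \ N) e + degree N e = degree F e := by
  unfold degree
  rw [← card_union_of_disjoint, ← filter_union, sdiff_union_of_subset h]
  exact disjoint_filter_filter disjoint_sdiff.symm

theorem degree_pos_iff {F : Finset (Finset V)} {e : Finset V} :
    0 < degree F e ↔ ∃ t ∈ F, e ⊆ t := by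
  simp [degree, card_pos, Finset.Nonempty]

theorem incidence_mulVec_indicator {A B Z : Finset (Finset V)} (hZ : Z ⊆ B) (a : A) :
    (incidence A B).mulVec (indicator B Z) a = degree Z a.1 := by
  simp only [Matrix.mulVec, dotProduct, incidence, Matrix.of_apply, indicator, mul_ite, mul_one,
    mul_zero, degree]
  rw [sum_coe_sort B (fun b : Finset V =>
    if b ∈ Z then (if a.1 ⊆ b then (1 : ZMod 2) else 0) else 0), ← sum_filter, filter_mem_eq_inter,
    inter_eq_right.mpr hZ, card_filter, Nat.cast_sum]
  simp

theorem incidence_transpose_mulVec {A B : Finset (Finset V)} (f : Finset V → ZMod 2) (b : B) :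
    (incidence A B).transpose.mulVec (fun a => f a) b = ∑ a ∈ A with a ⊆ b.1, f a := by
  simp only [Matrix.mulVec, dotProduct, incidence, Matrix.transpose_apply, Matrix.of_apply, ite_mul,
    one_mul, zero_mul]
  rw [sum_coe_sort A (fun a : Finset V => if a ⊆ b.1 then f a else 0), sum_filter]

theorem incidence_mulVec_indicator_eq_zero_iff {A B Z : Finset (Finset V)} (hZ : Z ⊆ B) :
    (incidence A B).mulVec (indicator B Z) = 0 ↔ ∀ a ∈ A, Even (degree Z a) := by
  rw [funext_iff]
  simp only [incidence_mulVec_indicator hZ, Pi.zero_apply, ZMod.natCast_eq_zero_iff_even,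
    Subtype.forall]

/-- Every vector over `ZMod 2` is an indicator vector. -/
theorem exists_eq_indicator (B : Finset (Finset V)) (x : B → ZMod 2) :
    ∃ Z ⊆ B, x = indicator B Z := by
  refine ⟨{b ∈ B | ∃ h : b ∈ B, x ⟨b, h⟩ = 1}, filter_subset _ _, ?_⟩
  funext b
  have h2 : ∀ c : ZMod 2, c ≠ 1 → c = 0 := by decide
  simp only [indicator, mem_filter, b.2, true_and, exists_true_left]
  split_ifs with h
  · exact h
  · exact h2 _ h

/-- Between a set and a superset with two more elements there are two intermediate sets. -/
theorem card_between {s t : Finset V} (hst : s ⊆ t) (hc : #t = #s + 2) {E : Finset (Finset V)}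
    (hE : ∀ e ∈ E, #e = #s + 1) (hE' : ∀ e, s ⊆ e → e ⊆ t → #e = #s + 1 → e ∈ E) :
    #{e ∈ E | s ⊆ e ∧ e ⊆ t} = 2 := by
  have h1 : #(t \ s) = 2 := by rw [card_sdiff_of_subset hst]; omega
  obtain ⟨a, b, hab, hts⟩ := card_eq_two.mp h1
  have ha : a ∈ t \ s := by simp [hts]
  have hb : b ∈ t \ s := by simp [hts]
  rw [mem_sdiff] at ha hb
  have h2 : {e ∈ E | s ⊆ e ∧ e ⊆ t} = {insert a s, insert b s} := by
    ext e
    simp only [mem_filter, mem_insert, mem_singleton]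
    constructor
    · rintro ⟨he, hse, het⟩
      have h3 : #(e \ s) = 1 := by rw [card_sdiff_of_subset hse, hE e he]; omega
      obtain ⟨c, hc⟩ := card_eq_one.mp h3
      have h4 : e = insert c s := by
        rw [← sdiff_union_of_subset hse, hc]; rfl
      have h5 : c ∈ t \ s := sdiff_subset_sdiff het subset_rfl (by simp [hc])
      rw [hts, mem_insert, mem_singleton] at h5
      rcases h5 with rfl | rfl
      · exact .inl h4
      · exact .inr h4
    · rintro (rfl | rfl)
      · have h3 := insert_subset ha.1 hst
        exact ⟨hE' _ (subset_insert _ _) h3 (card_insert_of_notMem ha.2), subset_insert _ _, h3⟩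
      · have h3 := insert_subset hb.1 hst
        exact ⟨hE' _ (subset_insert _ _) h3 (card_insert_of_notMem hb.2), subset_insert _ _, h3⟩
  rw [h2, card_pair]
  intro h
  have h3 : a ∈ insert b s := h ▸ mem_insert_self a s
  rcases mem_insert.mp h3 with h4 | h4
  · exact hab h4
  · exact ha.2 h4

/-- The boundary of a boundary vanishes. -/
theorem incidence_mul_incidence {k : ℕ} {A B C : Finset (Finset V)} (hA : ∀ a ∈ A, #a = k)
    (hB : ∀ b ∈ B, #b = k + 1) (hC : ∀ c ∈ C, #c = k + 2)
    (hBC : ∀ c ∈ C, ∀ b ⊆ c, #b = k + 1 → b ∈ B) :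
    incidence A B * incidence B C = 0 := by
  ext a c
  simp only [Matrix.mul_apply, incidence, Matrix.of_apply, Matrix.zero_apply, mul_ite, mul_one,
    mul_zero]
  rw [sum_coe_sort B (fun b : Finset V =>
    if b ⊆ c.1 then (if a.1 ⊆ b then (1 : ZMod 2) else 0) else 0), ← sum_filter, ← sum_filter,
    filter_filter, sum_const, nsmul_one]
  by_cases h : a.1 ⊆ c.1
  · have h1 := card_between h (by rw [hA _ a.2, hC _ c.2]) (E := B)
      (fun e he => by rw [hA _ a.2, hB e he])
      (fun e _ he hc => hBC c.1 c.2 e he (by rw [hc, hA _ a.2]))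
    simp only [and_comm] at h1 ⊢
    rw [h1]
    rfl
  · rw [filter_eq_empty_iff.mpr]
    · simp
    · exact fun b _ hb => h (hb.2.trans hb.1)

theorem rank_eq_card_of_ker {m n : Type*} [Fintype m] [Fintype n] {B : Matrix m n (ZMod 2)}
    (h : ∀ x, B.mulVec x = 0 → x = 0) : B.rank = Fintype.card n := by
  have h3 := B.mulVecLin.finrank_range_add_finrank_ker
  have h4 : LinearMap.ker B.mulVecLin = ⊥ := LinearMap.ker_eq_bot'.mpr h
  rw [Module.finrank_fintype_fun_eq_card, h4, finrank_bot] at h3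
  exact h3

/-- The kernel lies in the span of `x₀`, so rank–nullity applies. This is how connectedness enters
the rank counts, with `x₀` the all-ones vector. -/
theorem card_le_rank_add_one {m n : Type*} [Fintype m] [Fintype n] {B : Matrix m n (ZMod 2)}
    (x₀ : n → ZMod 2) (h : ∀ x, B.mulVec x = 0 → x = 0 ∨ x = x₀) :
    Fintype.card n ≤ B.rank + 1 := by
  have h3 := B.mulVecLin.finrank_range_add_finrank_ker
  have h4 : Module.finrank (ZMod 2) (LinearMap.ker B.mulVecLin) ≤ 1 := by
    refine (Submodule.finrank_mono (t := Submodule.span (ZMod 2) {x₀}) fun x hx => ?_).trans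
      ((finrank_span_le_card _).trans (by simp))
    rcases h x hx with rfl | rfl
    · exact zero_mem _
    · exact Submodule.mem_span_singleton_self _
  rw [Module.finrank_fintype_fun_eq_card] at h3
  simp only [Matrix.rank]
  omega

/-! ### Cores: triangle families without free edges and without 2-cycles. -/

/-- A nonempty family of triangles without free edges and without `ZMod 2`-cycles. -/
structure IsCore (F : Finset (Finset V)) : Prop where
  card_eq : ∀ t ∈ F, #t = 3
  nonempty : F.Nonempty
  degree_ne_one : ∀ e, #e = 2 → degree F e ≠ 1
  eq_empty_of_even : ∀ Z ⊆ F, (∀ e, #e = 2 → Even (degree Z e)) → Z = ∅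

/-- Strong connectedness of a family of triangles. -/
def IsStronglyConnected (F : Finset (Finset V)) : Prop :=
  ∀ G ⊆ F, G.Nonempty → (∀ t ∈ G, ∀ t' ∈ F, ∀ e, #e = 2 → e ⊆ t → e ⊆ t' → t' ∈ G) → G = F

/-- The vertices of a family of sets. -/
def verts (F : Finset (Finset V)) : Finset V := F.biUnion id

/-- The edges of a family of sets. -/
def edges (F : Finset (Finset V)) : Finset (Finset V) := F.biUnion (powersetCard 2)

theorem mem_verts {F : Finset (Finset V)} {a : V} : a ∈ verts F ↔ ∃ t ∈ F, a ∈ t := by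
  simp [verts]

theorem mem_edges {F : Finset (Finset V)} {e : Finset V} :
    e ∈ edges F ↔ ∃ t ∈ F, e ⊆ t ∧ #e = 2 := by
  simp [edges, mem_powersetCard]

theorem verts_mono {F G : Finset (Finset V)} (h : F ⊆ G) : verts F ⊆ verts G :=
  biUnion_subset_biUnion_of_subset_left _ h

/-- Take a smallest nonempty subfamily closed under adjacency across edges. All triangles over one
of its edges belong to it, so edge degrees, and with them the core property, are inherited. -/
theorem IsCore.exists_stronglyConnected {F : Finset (Finset V)} (hF : IsCore F) :
    ∃ G ⊆ F, IsCore G ∧ IsStronglyConnected G := by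
  classical
  let closed : Finset (Finset V) → Prop := fun G =>
    ∀ t ∈ G, ∀ t' ∈ F, ∀ e, #e = 2 → e ⊆ t → e ⊆ t' → t' ∈ G
  obtain ⟨G, hG, hmin⟩ := exists_min_image {G ∈ F.powerset | G.Nonempty ∧ closed G} card
    ⟨F, by simp only [mem_filter, mem_powerset]; exact
      ⟨subset_rfl, hF.nonempty, fun _ _ t' ht' _ _ _ _ => ht'⟩⟩
  simp only [mem_filter, mem_powerset] at hG hmin
  obtain ⟨hGF, hGne, hGc⟩ := hG
  refine ⟨G, hGF, ⟨fun t ht => hF.card_eq t (hGF ht), hGne, fun e he h1 => ?_,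
    fun Z hZ => hF.eq_empty_of_even Z (hZ.trans hGF)⟩, fun H hH hHne hHc => ?_⟩
  · obtain ⟨t, ht, het⟩ := degree_pos_iff.mp (h1 ▸ Nat.one_pos)
    apply hF.degree_ne_one e he
    rw [← h1]
    unfold degree
    congr 1
    ext t'
    simp only [mem_filter]
    exact ⟨fun h => ⟨hGc t ht t' h.1 e he het h.2, h.2⟩, fun h => ⟨hGF h.1, h.2⟩⟩
  · refine eq_of_subset_of_card_le hH (hmin H ⟨hH.trans hGF, hHne, ?_⟩)
    intro t ht t' ht' e he het het'
    exact hHc t ht t' (hGc t (hH ht) t' ht' e he het het') e he het het'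

theorem IsStronglyConnected.eq_of_const {F : Finset (Finset V)} (hF : IsStronglyConnected F)
    {g : V → ZMod 2} (hg : ∀ t ∈ F, ∀ a ∈ t, ∀ b ∈ t, g a = g b) {a b : V} (ha : a ∈ verts F)
    (hb : b ∈ verts F) : g a = g b := by
  obtain ⟨t, ht, hat⟩ := mem_verts.mp ha
  obtain ⟨t', ht', hbt⟩ := mem_verts.mp hb
  have h := hF {t ∈ F | ∀ c ∈ t, g a = g c} (filter_subset _ _)
    ⟨t, mem_filter.mpr ⟨ht, fun c hc => hg t ht a hat c hc⟩⟩ (by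
      intro s hs s' hs' e he hes hes'
      rw [mem_filter] at hs ⊢
      obtain ⟨d, hd⟩ : e.Nonempty := card_pos.mp (by omega)
      exact ⟨hs', fun c hc => (hs.2 d (hes hd)).trans (hg s' hs' d (hes' hd) c hc)⟩)
  rw [← h, mem_filter] at ht'
  exact ht'.2 b hbt

/-- In $\partial_1\partial_2=0$ the ranks add up to at most the number of edges. The absence of
cycles makes $\partial_2$ injective, and connectedness gives $\partial_1$ rank at least the number
of vertices minus one. -/
theorem IsCore.card_add_card_verts_le {F : Finset (Finset V)} (hF : IsCore F)
    (hc : IsStronglyConnected F) : #F + #(verts F) ≤ #(edges F) + 1 := by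
  set A : Finset (Finset V) := (verts F).image fun a => {a} with hA
  have hAc : #A = #(verts F) := card_image_of_injective _ singleton_injective
  have hmemA : ∀ a, {a} ∈ A ↔ a ∈ verts F := by
    intro a
    simp [hA]
  have h0 : incidence A (edges F) * incidence (edges F) F = 0 := by
    refine incidence_mul_incidence (k := 1) ?_ ?_ ?_ ?_
    · intro a ha
      obtain ⟨b, -, rfl⟩ := mem_image.mp ha
      simp
    · intro b hb
      obtain ⟨t, -, -, h⟩ := mem_edges.mp hb
      exact h
    · exact hF.card_eq
    · exact fun t ht e het he => mem_edges.mpr ⟨t, ht, het, he⟩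
  have h1 := Matrix.rank_add_rank_le_card_of_mul_eq_zero h0
  have h2 : (incidence (edges F) F).rank = Fintype.card F := by
    refine rank_eq_card_of_ker fun x hx => ?_
    obtain ⟨Z, hZ, rfl⟩ := exists_eq_indicator F x
    rw [incidence_mulVec_indicator_eq_zero_iff hZ] at hx
    have h3 : Z = ∅ := hF.eq_empty_of_even Z hZ fun e he => by
      by_cases h : e ∈ edges F
      · exact hx e h
      · have : degree Z e = 0 := by
          by_contra h4
          obtain ⟨t, ht, het⟩ := degree_pos_iff.mp (Nat.pos_of_ne_zero h4)
          exact h (mem_edges.mpr ⟨t, hZ ht, het, he⟩)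
        rw [this]
        exact Even.zero
    funext b
    simp [indicator, h3]
  have h3 : Fintype.card A ≤ (incidence A (edges F)).transpose.rank + 1 := by
    refine card_le_rank_add_one (fun _ => 1) fun x hx => ?_
    obtain ⟨Z, hZ, rfl⟩ := exists_eq_indicator A x
    have hedge : ∀ t ∈ F, ∀ a ∈ t, ∀ b ∈ t,
        (if {a} ∈ Z then (1 : ZMod 2) else 0) = if {b} ∈ Z then 1 else 0 := by
      intro t ht a ha b hb
      by_cases hab : a = b
      · rw [hab]
      have he : {a, b} ∈ edges F := mem_edges.mpr ⟨t, ht, by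
        simp [insert_subset_iff, ha, hb], card_pair hab⟩
      have h4 := congrFun hx ⟨_, he⟩
      have h5 := incidence_transpose_mulVec (A := A)
        (fun s => if s ∈ Z then (1 : ZMod 2) else 0) ⟨_, he⟩
      have h6 : {s ∈ A | s ⊆ {a, b}} = {{a}, {b}} := by
        ext s
        simp only [mem_filter, mem_insert, mem_singleton, hA, mem_image]
        constructor
        · rintro ⟨⟨c, -, rfl⟩, h⟩
          simpa using h
        · rintro (rfl | rfl)
          · exact ⟨⟨a, mem_verts.mpr ⟨t, ht, ha⟩, rfl⟩, by simp⟩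
          · exact ⟨⟨b, mem_verts.mpr ⟨t, ht, hb⟩, rfl⟩, by simp⟩
      rw [h6, sum_pair (by simpa using hab)] at h5
      have h7 : (if {a} ∈ Z then (1 : ZMod 2) else 0) + (if {b} ∈ Z then 1 else 0) = 0 :=
        h5.symm.trans h4
      have h8 : ∀ x y : ZMod 2, x + y = 0 → x = y := by decide
      exact h8 _ _ h7
    obtain ⟨t, ht⟩ := hF.nonempty
    obtain ⟨a, ha⟩ : t.Nonempty := card_pos.mp (by rw [hF.card_eq t ht]; omega)
    have hav : a ∈ verts F := mem_verts.mpr ⟨t, ht, ha⟩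
    have hconst : ∀ s : A, indicator A Z s = if {a} ∈ Z then 1 else 0 := by
      rintro ⟨s, hs⟩
      obtain ⟨b, hb, rfl⟩ := mem_image.mp hs
      exact hc.eq_of_const (g := fun a => if {a} ∈ Z then (1 : ZMod 2) else 0) hedge hb hav
    by_cases h : {a} ∈ Z
    · right
      funext s
      simp [hconst, h]
    · left
      funext s
      simp [hconst, h]
  rw [Matrix.rank_transpose] at h3
  rw [Fintype.card_coe] at h1 h2 h3
  omega

theorem sum_degree (E F : Finset (Finset V)) :
    ∑ e ∈ E, degree F e = ∑ t ∈ F, #{e ∈ E | e ⊆ t} :=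
  sum_card_bipartiteAbove_eq_sum_card_bipartiteBelow (s := E) (t := F)
    (fun e t : Finset V => e ⊆ t)

theorem sum_degree_edges {F : Finset (Finset V)} (hF : ∀ t ∈ F, #t = 3) :
    ∑ e ∈ edges F, degree F e = 3 * #F := by
  rw [sum_degree, mul_comm, ← smul_eq_mul, ← sum_const]
  refine sum_congr rfl fun t ht => ?_
  have : {e ∈ edges F | e ⊆ t} = powersetCard 2 t := by
    ext e
    simp only [mem_filter, mem_edges, mem_powersetCard]
    exact ⟨fun h => ⟨h.2, h.1.choose_spec.2.2⟩, fun h => ⟨⟨t, ht, h⟩, h.1⟩⟩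
  rw [this, card_powersetCard, hF t ht]
  rfl

/-- The edges of odd degree. -/
def oddEdges (F : Finset (Finset V)) : Finset (Finset V) := {e ∈ edges F | Odd (degree F e)}

/-- Each triangle at `v` has exactly two edges through `v`, so the degrees of the edges at `v` have
an even sum. -/
theorem even_card_oddEdges_mem {F : Finset (Finset V)} (hF : ∀ t ∈ F, #t = 3) (v : V) :
    Even #{e ∈ oddEdges F | v ∈ e} := by
  have h1 : Even (∑ e ∈ edges F with v ∈ e, degree F e) := by
    rw [sum_degree]
    refine even_sum _ fun t ht => ?_
    by_cases hv : v ∈ t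
    · have h2 := card_between (s := {v}) (t := t) (by simpa using hv) (by rw [hF t ht]; rfl)
        (E := edges F) (fun e he => by
          obtain ⟨-, -, -, h⟩ := mem_edges.mp he
          simpa using h) (fun e _ het h => mem_edges.mpr ⟨t, ht, het, by simpa using h⟩)
      simp only [singleton_subset_iff] at h2
      rw [filter_filter, h2]
      exact even_two
    · rw [filter_filter, filter_eq_empty_iff.mpr fun e _ h => hv (h.2 h.1)]
      exact Even.zero
  rw [even_sum_iff_even_card_odd] at h1
  rw [filter_filter] at h1
  rw [oddEdges, filter_filter]
  simpa only [and_comm] using h1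

/-- A nonempty graph with even degrees contains a path with three edges or a triangle; if it has
at most three edges it is a triangle. -/
theorem exists_triangle_of_even {O : Finset (Finset V)} (hO : ∀ e ∈ O, #e = 2) (hne : O.Nonempty)
    (heven : ∀ v, Even #{e ∈ O | v ∈ e}) :
    3 ≤ #O ∧ (#O ≤ 3 → ∃ a b c, a ≠ b ∧ a ≠ c ∧ b ≠ c ∧ O = {{a, b}, {a, c}, {b, c}}) := by
  -- No edge ends in a leaf: even degree at a vertex of an edge forces a further edge there.
  have other : ∀ e ∈ O, ∀ v ∈ e, ∃ w, {v, w} ∈ O ∧ {v, w} ≠ e ∧ v ≠ w := by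
    intro e he v hv
    have h1 : 1 < #{e ∈ O | v ∈ e} := by
      have h2 : 0 < #{e ∈ O | v ∈ e} := card_pos.mpr ⟨e, mem_filter.mpr ⟨he, hv⟩⟩
      obtain ⟨k, hk⟩ := heven v
      omega
    obtain ⟨e', he', hne'⟩ := exists_mem_ne h1 e
    rw [mem_filter] at he'
    obtain ⟨x, y, hxy, rfl⟩ := card_eq_two.mp (hO e' he'.1)
    rcases mem_insert.mp he'.2 with rfl | h
    · exact ⟨y, he'.1, hne', hxy⟩
    · rw [mem_singleton] at h
      subst h
      exact ⟨x, by rw [pair_comm]; exact he'.1, by rwa [pair_comm], hxy.symm⟩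
  obtain ⟨e, he⟩ := hne
  obtain ⟨a, b, hab, rfl⟩ := card_eq_two.mp (hO e he)
  obtain ⟨c, hac, hac', hac''⟩ := other _ he a (by simp)
  obtain ⟨d, hbd, hbd', hbd''⟩ := other _ he b (by simp)
  have hbc : b ≠ c := by rintro rfl; exact hac' rfl
  have had : a ≠ d := by rintro rfl; exact hbd' (pair_comm _ _)
  have hne2 : ({a, c} : Finset V) ≠ {b, d} := by
    intro h
    have : a ∈ ({b, d} : Finset V) := h ▸ mem_insert_self a _
    simp [hab, had] at this
  have hsub : ({{a, b}, {a, c}, {b, d}} : Finset (Finset V)) ⊆ O := by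
    simp [insert_subset_iff, he, hac, hbd]
  have hcard : #({{a, b}, {a, c}, {b, d}} : Finset (Finset V)) = 3 :=
    card_eq_three.mpr ⟨_, _, _, hac'.symm, hbd'.symm, hne2, rfl⟩
  refine ⟨hcard ▸ card_le_card hsub, fun h3 => ?_⟩
  have hO3 := eq_of_subset_of_card_le hsub (by omega)
  obtain ⟨x, hx, hx', hcx⟩ := other _ hac c (by simp)
  have hcd : c = d := by
    have hc : c ∈ ({c, x} : Finset V) := by simp
    rw [← hO3] at hx
    simp only [mem_insert, mem_singleton] at hx
    rcases hx with h | h | h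
    · rw [h] at hc; simp [hac''.symm, hbc.symm] at hc
    · exact absurd h hx'
    · rw [h] at hc; simpa [hbc.symm] using hc
  subst hcd
  exact ⟨a, b, c, hab, hac'', hbc, hO3.symm⟩

theorem IsCore.two_le_degree {F : Finset (Finset V)} (hF : IsCore F) {e : Finset V}
    (he : e ∈ edges F) : 2 ≤ degree F e := by
  obtain ⟨t, ht, het, hc⟩ := mem_edges.mp he
  have h1 : 0 < degree F e := degree_pos_iff.mpr ⟨t, ht, het⟩
  have h2 := hF.degree_ne_one e hc
  omega

theorem IsCore.oddEdges_nonempty {F : Finset (Finset V)} (hF : IsCore F) :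
    (oddEdges F).Nonempty := by
  by_contra h
  rw [not_nonempty_iff_eq_empty] at h
  refine hF.nonempty.ne_empty (hF.eq_empty_of_even F subset_rfl fun e he => ?_)
  by_contra h1
  rw [Nat.not_even_iff_odd] at h1
  obtain ⟨t, ht, het⟩ := degree_pos_iff.mp h1.pos
  have h2 : e ∈ oddEdges F := mem_filter.mpr ⟨mem_edges.mpr ⟨t, ht, het, he⟩, h1⟩
  simp [h] at h2

theorem edges_subset (F : Finset (Finset V)) : edges F ⊆ powersetCard 2 (verts F) := by
  intro e he
  obtain ⟨t, ht, het, hc⟩ := mem_edges.mp he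
  exact mem_powersetCard.mpr ⟨fun a ha => mem_verts.mpr ⟨t, ht, het ha⟩, hc⟩

/-- A small strongly connected core has `f`-vector `(7, 21, 15)`, and exactly three edges, which
form a triangle, lie in three of its triangles, while all other edges lie in two. -/
theorem IsCore.structure_of_small {F : Finset (Finset V)} (hF : IsCore F)
    (hc : IsStronglyConnected F) (hs : #(verts F) ≤ 7 ∨ #F ≤ 16) :
    #(verts F) = 7 ∧ #F = 15 ∧ edges F = powersetCard 2 (verts F) ∧
      (∃ a b c, a ≠ b ∧ a ≠ c ∧ b ≠ c ∧ oddEdges F = {{a, b}, {a, c}, {b, c}}) ∧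
      ∀ e ∈ edges F, degree F e = if e ∈ oddEdges F then 3 else 2 := by
  have hO2 : ∀ e ∈ oddEdges F, #e = 2 := fun e he =>
    (mem_edges.mp (mem_filter.mp he).1).choose_spec.2.2
  obtain ⟨h3, htri⟩ := exists_triangle_of_even hO2 hF.oddEdges_nonempty
    (even_card_oddEdges_mem hF.card_eq)
  have hle : ∀ e ∈ edges F, (2 + if e ∈ oddEdges F then 1 else 0) ≤ degree F e := by
    intro e he
    have h1 := hF.two_le_degree he
    split_ifs with h
    · obtain ⟨k, hk⟩ := (mem_filter.mp h).2
      omega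
    · exact h1
  have hsum : ∑ e ∈ edges F, (2 + if e ∈ oddEdges F then 1 else 0) =
      2 * #(edges F) + #(oddEdges F) := by
    rw [sum_add_distrib, sum_const, smul_eq_mul, mul_comm, sum_boole, filter_mem_eq_inter,
      inter_eq_right.mpr (show oddEdges F ⊆ edges F from filter_subset _ _)]
    rfl
  have h1 := sum_le_sum hle
  rw [hsum, sum_degree_edges hF.card_eq] at h1
  have h2 := hF.card_add_card_verts_le hc
  have h4 := card_le_card (edges_subset F)
  rw [card_powersetCard] at h4
  obtain ⟨t, ht⟩ := hF.nonempty
  obtain ⟨a, ha⟩ : t.Nonempty := card_pos.mp (by rw [hF.card_eq t ht]; omega)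
  have h5 : 0 < #(verts F) := card_pos.mpr ⟨a, mem_verts.mpr ⟨t, ht, ha⟩⟩
  -- With $k$ vertices, $E$ edges, $T$ triangles and $o\ge 3$ odd edges, $2E+o\le 3T$ and $T+k\le
  -- E+1$ give $T\ge 2k+1$; so $T\le 16$ also implies $k\le 7$. Against $E\le\binom k2$ only $k=7$
  -- survives, with equality throughout.
  have h6 : #(verts F) ≤ 7 := by omega
  have h7 : #(verts F) = 7 ∧ #(edges F) = 21 ∧ #F = 15 ∧ #(oddEdges F) = 3 := by
    generalize #(verts F) = k at *
    interval_cases k <;> simp only [Nat.choose] at h4 <;> omega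
  obtain ⟨hk0, hk1, hk2, ho⟩ := h7
  refine ⟨hk0, hk2, ?_, htri ho.le, ?_⟩
  · refine eq_of_subset_of_card_le (edges_subset F) ?_
    rw [card_powersetCard, hk0, hk1]
    rfl
  · have h8 := (sum_eq_sum_iff_of_le hle).mp (by
      rw [hsum, sum_degree_edges hF.card_eq, hk1, hk2, ho])
    intro e he
    rw [← h8 e he]
    split_ifs <;> rfl

/-- A core contains no three triangles that cone off a triangle of odd edges. -/
theorem IsCore.not_cone {F : Finset (Finset V)} (hF : IsCore F) (hFc : 4 ≤ #F) {a b c x : V}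
    (hab : a ≠ b) (hac : a ≠ c) (hbc : b ≠ c) (hxa : x ≠ a) (hxb : x ≠ b) (hxc : x ≠ c)
    (hO : oddEdges F = {{a, b}, {a, c}, {b, c}}) (h₁ : {x, a, b} ∈ F) (h₂ : {x, a, c} ∈ F)
    (h₃ : {x, b, c} ∈ F) : False := by
  set N : Finset (Finset V) := {{x, a, b}, {x, a, c}, {x, b, c}} with hN
  have hNF : N ⊆ F := by simp [hN, insert_subset_iff, h₁, h₂, h₃]
  have hNc : #N ≤ 3 := card_le_three
  have hodd : ∀ e, #e = 2 → (Odd (degree F e) ↔ e ∈ oddEdges F) := by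
    intro e he
    refine ⟨fun h => ?_, fun h => (mem_filter.mp h).2⟩
    obtain ⟨t, ht, het⟩ := degree_pos_iff.mp h.pos
    exact mem_filter.mpr ⟨mem_edges.mpr ⟨t, ht, het, he⟩, h⟩
  have hd₁ : ({x, a, b} : Finset V) ∉ ({{x, a, c}, {x, b, c}} : Finset (Finset V)) := by
    simp only [mem_insert, mem_singleton, not_or]
    constructor
    · intro h
      have : b ∈ ({x, a, c} : Finset V) := h ▸ by simp
      simp [hxb.symm, hab.symm, hbc] at this
    · intro h
      have : a ∈ ({x, b, c} : Finset V) := h ▸ by simp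
      simp [hxa.symm, hab, hac] at this
  have hd₂ : ({x, a, c} : Finset V) ∉ ({{x, b, c}} : Finset (Finset V)) := by
    rw [mem_singleton]
    intro h
    have : a ∈ ({x, b, c} : Finset V) := h ▸ by simp
    simp [hxa.symm, hab, hac] at this
  have hNdeg : ∀ e, degree N e = (if e ⊆ {x, a, b} then 1 else 0) +
      ((if e ⊆ {x, a, c} then 1 else 0) + if e ⊆ {x, b, c} then 1 else 0) := by
    intro e
    rw [degree, card_filter, hN, sum_insert hd₁, sum_insert hd₂, sum_singleton]
  have hpair : ∀ e : Finset V, #e = 2 → (Odd (degree N e) ↔ e ∈ oddEdges F) := by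
    intro e he
    obtain ⟨u, v, huv, rfl⟩ := card_eq_two.mp he
    rw [hNdeg, hO]
    simp only [insert_subset_iff, singleton_subset_iff, mem_insert, mem_singleton]
    have hp : ∀ p q : V, (({u, v} : Finset V) = {p, q}) ↔ (u = p ∧ v = q) ∨ (u = q ∧ v = p) := by
      intro p q
      rw [← coe_inj, coe_pair, coe_pair, Set.pair_eq_pair_iff]
    rw [hp, hp, hp]
    have key : ∀ p : V, (p = x ∧ p ≠ a ∧ p ≠ b ∧ p ≠ c) ∨ (p = a ∧ p ≠ x ∧ p ≠ b ∧ p ≠ c) ∨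
        (p = b ∧ p ≠ a ∧ p ≠ x ∧ p ≠ c) ∨ (p = c ∧ p ≠ a ∧ p ≠ b ∧ p ≠ x) ∨
        (p ≠ x ∧ p ≠ a ∧ p ≠ b ∧ p ≠ c) := by
      intro p
      grind
    rcases key u with ⟨hu, hu1, hu2, hu3⟩ | ⟨hu, hu1, hu2, hu3⟩ | ⟨hu, hu1, hu2, hu3⟩ |
        ⟨hu, hu1, hu2, hu3⟩ | ⟨hu, hu1, hu2, hu3⟩ <;>
      rcases key v with ⟨hv, hv1, hv2, hv3⟩ | ⟨hv, hv1, hv2, hv3⟩ | ⟨hv, hv1, hv2, hv3⟩ |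
        ⟨hv, hv1, hv2, hv3⟩ | ⟨hv, hv1, hv2, hv3⟩ <;>
      first
      | exact absurd (hu.trans hv.symm) huv
      | (simp only [hu1, hu2, hu3, hv1, hv2, hv3, hu, hv, hxa, hxb, hxc, hab, hac, hbc, hxa.symm,
          hxb.symm, hxc.symm, hab.symm, hac.symm, hbc.symm]; decide)
  -- The odd edges of the cone `N` are exactly those of `F`: its edges at `x` have degree two in it.
  -- So `F \ N` is a cycle.
  have hempty := hF.eq_empty_of_even (F \ N) sdiff_subset fun e he => by
    have h1 := degree_sdiff hNF e
    have h2 := (hodd e he).trans (hpair e he).symm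
    by_contra h
    rw [Nat.not_even_iff_odd] at h
    rw [← h1, Nat.odd_add, iff_true_left h] at h2
    rw [← Nat.not_odd_iff_even] at h2
    exact iff_not_self h2.symm
  have h1 := card_sdiff_of_subset hNF
  rw [hempty, card_empty] at h1
  omega

/-- A core has at least eight vertices and at least seventeen triangles. -/
theorem IsStronglyConnected.bounds {F : Finset (Finset V)} (hc : IsStronglyConnected F)
    (hF : IsCore F) (hs : #(verts F) ≤ 7 ∨ #F ≤ 16) : False := by
  obtain ⟨hk0, hk2, hE, ⟨a, b, c, hab, hac, hbc, hO⟩, hdeg⟩ := hF.structure_of_small hc hs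
  have hedge : ∀ {p q}, p ∈ verts F → q ∈ verts F → p ≠ q → {p, q} ∈ edges F := by
    intro p q hp hq hpq
    rw [hE, mem_powersetCard]
    exact ⟨by simp [insert_subset_iff, hp, hq], card_pair hpq⟩
  set A : Finset V := {a, b, c} with hA
  have hAc : #A = 3 := card_eq_three.mpr ⟨a, b, c, hab, hac, hbc, rfl⟩
  have hOA : ∀ e ∈ oddEdges F, e ⊆ A := by
    intro e he
    rw [hO] at he
    simp only [mem_insert, mem_singleton] at he
    rcases he with rfl | rfl | rfl <;> simp [hA, insert_subset_iff]
  have hAv : A ⊆ verts F := by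
    have : ∀ e ∈ oddEdges F, e ⊆ verts F := fun e he =>
      (mem_powersetCard.mp (hE ▸ (mem_filter.mp he).1)).1
    have h1 := this {a, b} (by simp [hO])
    have h2 := this {b, c} (by simp [hO])
    simp only [insert_subset_iff, singleton_subset_iff] at h1 h2
    simp [hA, insert_subset_iff, h1, h2]
  -- If the triangle spanned by the odd edges belonged to `F`, deleting it would leave a nonzero
  -- cycle.
  have hAF : A ∉ F := by
    intro hAF
    have hsub : ({A} : Finset (Finset V)) ⊆ F := by simpa using hAF
    have hempty := hF.eq_empty_of_even (F \ {A}) sdiff_subset fun e he => by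
      have h1 := degree_sdiff hsub e
      have h2 : degree {A} e = if e ⊆ A then 1 else 0 := by
        rw [degree, card_filter, sum_singleton]
      by_cases heA : e ⊆ A
      · have heO : e ∈ oddEdges F := by
          have h3 : e ∈ powersetCard 2 A := mem_powersetCard.mpr ⟨heA, he⟩
          have h4 : oddEdges F = powersetCard 2 A := by
            refine eq_of_subset_of_card_le (fun e he => mem_powersetCard.mpr ⟨hOA e he, ?_⟩) ?_
            · exact (mem_powersetCard.mp (hE ▸ (mem_filter.mp he).1)).2
            · rw [card_powersetCard, hAc]
              exact (exists_triangle_of_even (fun e he =>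
                (mem_powersetCard.mp (hE ▸ (mem_filter.mp he).1)).2) hF.oddEdges_nonempty
                (even_card_oddEdges_mem hF.card_eq)).1
          rwa [h4]
        have h5 := hdeg e (mem_filter.mp heO).1
        rw [if_pos heO] at h5
        rw [h2, if_pos heA, h5] at h1
        exact ⟨1, by omega⟩
      · have heO : e ∉ oddEdges F := fun h => heA (hOA e h)
        rw [h2, if_neg heA, add_zero] at h1
        rw [h1, ← Nat.not_odd_iff_even]
        intro h
        obtain ⟨t, ht, het⟩ := degree_pos_iff.mp h.pos
        exact heO (mem_filter.mpr ⟨mem_edges.mpr ⟨t, ht, het, he⟩, h⟩)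
    have h1 := card_sdiff_of_subset hsub
    rw [hempty, card_empty, card_singleton, hk2] at h1
    omega
  set W := verts F \ A with hW
  have hWc : #W = 4 := by rw [hW, card_sdiff_of_subset hAv, hk0, hAc]
  have hAW : Disjoint A W := disjoint_sdiff
  have hWA : ∀ {w}, w ∈ W → w ∉ A := fun h => (mem_sdiff.mp h).2
  have hWv : ∀ {w}, w ∈ W → w ∈ verts F := fun h => (mem_sdiff.mp h).1
  have hdeg2 : ∀ {p q}, p ∈ verts F → q ∈ W → p ≠ q → degree F {p, q} = 2 := by
    intro p q hp hq hpq
    rw [hdeg _ (hedge hp (hWv hq) hpq), if_neg]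
    exact fun h => hWA hq (hOA _ h (by simp))
  -- Count incidences with the twelve edges between `A` and `W`, each of degree two. A triangle
  -- outside `W` has exactly two such edges, so twelve of the fifteen triangles are mixed and three
  -- lie in `W`.
  have hmix : 12 * 2 = ∑ t ∈ F, #(A ∩ t) * #(W ∩ t) := by
    have h1 : ∑ p ∈ A ×ˢ W, degree F {p.1, p.2} = ∑ t ∈ F, #(A ∩ t) * #(W ∩ t) := by
      refine (sum_card_bipartiteAbove_eq_sum_card_bipartiteBelow (s := A ×ˢ W) (t := F)
        (fun (p : V × V) t => ({p.1, p.2} : Finset V) ⊆ t)).trans ?_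
      refine sum_congr rfl fun t _ => ?_
      rw [← card_product]
      congr 1
      ext p
      simp only [bipartiteBelow, mem_filter, mem_product, insert_subset_iff, singleton_subset_iff,
        mem_inter]
      tauto
    rw [← h1]
    have h2 : ∀ p ∈ A ×ˢ W, degree F {p.1, p.2} = 2 := by
      intro p hp
      rw [mem_product] at hp
      exact hdeg2 (hAv hp.1) hp.2 fun h => hWA hp.2 (h ▸ hp.1)
    rw [sum_congr rfl h2, sum_const, card_product, hAc, hWc]
    rfl
  have hterm : ∀ t ∈ F, #(A ∩ t) * #(W ∩ t) = if t ⊆ W then 0 else 2 := by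
    intro t ht
    have htv : t ⊆ A ∪ W := by
      intro x hx
      have := mem_verts.mpr ⟨t, ht, hx⟩
      by_cases h : x ∈ A
      · exact mem_union_left _ h
      · exact mem_union_right _ (mem_sdiff.mpr ⟨this, h⟩)
    have h1 : #(A ∩ t) + #(W ∩ t) = 3 := by
      rw [← card_union_of_disjoint (hAW.mono inter_subset_left inter_subset_left),
        ← union_inter_distrib_right, inter_eq_right.mpr htv, hF.card_eq t ht]
    have h2 : #(A ∩ t) ≠ 3 := by
      intro h
      have h3 : A ∩ t = A := eq_of_subset_of_card_le inter_subset_left (by omega)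
      have h4 : A ∩ t = t := eq_of_subset_of_card_le inter_subset_right
        (by rw [hF.card_eq t ht]; omega)
      exact hAF (h3.symm.trans h4 ▸ ht)
    split_ifs with h
    · have : A ∩ t = ∅ := disjoint_iff_inter_eq_empty.mp (hAW.mono_right h)
      rw [this]; simp
    · have h3 : #(W ∩ t) ≠ 3 := by
        intro h4
        have h5 : W ∩ t = t := eq_of_subset_of_card_le inter_subset_right
          (by rw [hF.card_eq t ht]; omega)
        exact h (inter_eq_right.mp h5)
      generalize #(A ∩ t) = i at *
      generalize #(W ∩ t) = j at *
      have : i = 1 ∧ j = 2 ∨ i = 2 ∧ j = 1 := by omega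
      rcases this with ⟨rfl, rfl⟩ | ⟨rfl, rfl⟩ <;> rfl
  rw [sum_congr rfl hterm, sum_ite, sum_const, sum_const, smul_zero, zero_add, smul_eq_mul] at hmix
  have hT0 : #{t ∈ F | t ⊆ W} = 3 := by
    have := card_filter_add_card_filter_not (s := F) (fun t => t ⊆ W)
    omega
  have hT0sub : {t ∈ F | t ⊆ W} ⊆ powersetCard 3 W := by
    intro t ht
    rw [mem_filter] at ht
    exact mem_powersetCard.mpr ⟨ht.2, hF.card_eq t ht.1⟩
  have hmiss : #(powersetCard 3 W \ {t ∈ F | t ⊆ W}) = 1 := by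
    rw [card_sdiff_of_subset hT0sub, hT0, card_powersetCard, hWc]
    rfl
  obtain ⟨u, hu⟩ := card_eq_one.mp hmiss
  have huW : u ∈ powersetCard 3 W := (mem_sdiff.mp (hu ▸ mem_singleton_self u :
    u ∈ powersetCard 3 W \ {t ∈ F | t ⊆ W})).1
  rw [mem_powersetCard] at huW
  -- Exactly one triple of `W` is missing from `F`. The vertex `x` of `W` outside it lies in all
  -- three triangles of `F` inside `W`.
  obtain ⟨x, hxW, hxu⟩ := exists_mem_notMem_of_card_lt_card (s := u) (t := W) (by omega)
  have hin : ∀ y ∈ W, y ≠ x → W.erase y ∈ F := by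
    intro y hy hyx
    by_contra h
    have h1 : W.erase y ∈ powersetCard 3 W \ {t ∈ F | t ⊆ W} := by
      rw [mem_sdiff, mem_powersetCard, card_erase_of_mem hy, hWc, mem_filter]
      exact ⟨⟨erase_subset _ _, rfl⟩, fun h2 => h h2.1⟩
    rw [hu, mem_singleton] at h1
    exact hxu (h1 ▸ mem_erase.mpr ⟨hyx.symm, hxW⟩)
  have hxA : x ∉ A := hWA hxW
  -- An edge from `x` to another vertex of `W` already lies in two triangles inside `W`, which
  -- exhausts its degree.
  have hlink : ∀ z ∈ W, z ≠ x → ∀ p ∈ A, ∀ t ∈ F, x ∈ t → z ∈ t → p ∉ t := by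
    intro z hz hzx p hp t ht hxt hzt hpt
    have h1 : #(W \ {x, z}) = 2 := by
      rw [card_sdiff_of_subset (by simp [insert_subset_iff, hxW, hz]), hWc, card_pair hzx.symm]
    obtain ⟨y, y', hyy, hy⟩ := card_eq_two.mp h1
    have hyW : y ∈ W \ {x, z} := by simp [hy]
    have hyW' : y' ∈ W \ {x, z} := by simp [hy]
    simp only [mem_sdiff, mem_insert, mem_singleton, not_or] at hyW hyW'
    have hsub : ({W.erase y, W.erase y', t} : Finset (Finset V)) ⊆ {t ∈ F | {z, x} ⊆ t} := by
      simp only [insert_subset_iff, singleton_subset_iff, mem_filter, mem_erase]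
      exact ⟨⟨hin y hyW.1 hyW.2.1, ⟨Ne.symm hyW.2.2, hz⟩, Ne.symm hyW.2.1, hxW⟩,
        ⟨hin y' hyW'.1 hyW'.2.1, ⟨Ne.symm hyW'.2.2, hz⟩, Ne.symm hyW'.2.1, hxW⟩, ht, hzt, hxt⟩
    have hpW : p ∉ W := fun h => hWA h hp
    have h2 : #({W.erase y, W.erase y', t} : Finset (Finset V)) = 3 := by
      refine card_eq_three.mpr ⟨_, _, _, ?_, ?_, ?_, rfl⟩
      · intro h
        have : y ∈ W.erase y := h ▸ mem_erase.mpr ⟨hyy, hyW.1⟩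
        simp at this
      · rintro rfl
        exact hpW (mem_of_mem_erase hpt)
      · rintro rfl
        exact hpW (mem_of_mem_erase hpt)
    have h3 := card_le_card hsub
    have h4 := hdeg2 (hWv hz) hxW hzx
    rw [degree] at h4
    omega
  -- Triangles over the edge from `x` to `p` can therefore only have their third vertex in `A`, and
  -- degree two makes both of them occur. So `F` contains the cone from `x` over the odd triangle.
  have hcone : ∀ {p q r}, p ≠ q → p ≠ r → q ≠ r → A = {p, q, r} → {x, p, q} ∈ F ∧ {x, p, r} ∈ F := by
    intro p q r hpq hpr hqr hApqr
    have hp : p ∈ A := by simp [hApqr]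
    have hpx : p ≠ x := by rintro rfl; exact hxA hp
    have hsub : {t ∈ F | {p, x} ⊆ t} ⊆ {{x, p, q}, {x, p, r}} := by
      intro t ht
      simp only [mem_filter, insert_subset_iff, singleton_subset_iff] at ht
      obtain ⟨htF, hpt, hxt⟩ := ht
      have h1 : #(t \ {x, p}) = 1 := by
        rw [card_sdiff_of_subset (by simp [insert_subset_iff, hxt, hpt]), hF.card_eq t htF,
          card_pair hpx.symm]
      obtain ⟨s, hs⟩ := card_eq_one.mp h1
      have hst : s ∈ t \ {x, p} := by simp [hs]
      simp only [mem_sdiff, mem_insert, mem_singleton, not_or] at hst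
      have ht3 : t = {x, p, s} := by
        rw [← sdiff_union_of_subset (show ({x, p} : Finset V) ⊆ t by
          simp [insert_subset_iff, hxt, hpt]), hs]
        ext; simp; tauto
      have hsA : s ∈ A := by
        by_contra h
        have hsW : s ∈ W := mem_sdiff.mpr ⟨mem_verts.mpr ⟨t, htF, hst.1⟩, h⟩
        exact hlink s hsW hst.2.1 p hp t htF hxt hst.1 hpt
      rw [hApqr] at hsA
      simp only [mem_insert, mem_singleton] at hsA ⊢
      rcases hsA with h | h | h
      · exact absurd h hst.2.2
      · left; rw [ht3, h]
      · right; rw [ht3, h]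
    have h2 := hdeg2 (hAv hp) hxW hpx
    have h3 := eq_of_subset_of_card_le hsub (by
      rw [degree] at h2
      rw [h2]
      exact card_le_two)
    have h4 : ({x, p, q} : Finset V) ∈ {t ∈ F | {p, x} ⊆ t} := by rw [h3]; simp
    have h5 : ({x, p, r} : Finset V) ∈ {t ∈ F | {p, x} ⊆ t} := by rw [h3]; simp
    exact ⟨(mem_filter.mp h4).1, (mem_filter.mp h5).1⟩
  simp only [hA, mem_insert, mem_singleton, not_or] at hxA
  obtain ⟨h₁, h₂⟩ := hcone hab hac hbc rfl
  obtain ⟨-, h₃⟩ := hcone hab.symm hbc hac (by rw [hA]; ext; simp; tauto)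
  exact hF.not_cone (by omega) hab hac hbc hxA.1 hxA.2.1 hxA.2.2 hO h₁ h₂ h₃

/-- A family of triangles without free edges and without `ZMod 2`-cycles has at least eight
vertices and at least seventeen members. -/
theorem IsCore.bounds {F : Finset (Finset V)} (hF : IsCore F) : 8 ≤ #(verts F) ∧ 17 ≤ #F := by
  obtain ⟨G, hGF, hG, hGc⟩ := hF.exists_stronglyConnected
  have h1 := card_le_card (verts_mono hGF)
  have h2 := card_le_card hGF
  by_contra h
  exact hGc.bounds hG (by omega)

end FaceFamily

/-! ### Homology of a triangulated 3-sphere by rank counting. -/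

namespace SphereHomology

open Finset FaceFamily SphereTopology

universe u

variable {V : Type u} [Fintype V]

open Classical in
/-- The faces of `K` with `k` vertices. -/
noncomputable def level (K : PreAbstractSimplicialComplex V) (k : ℕ) : Finset (Finset V) :=
  {σ | σ ∈ K.faces ∧ #σ = k}

variable {S K : PreAbstractSimplicialComplex V}

theorem mem_level {k : ℕ} {σ : Finset V} : σ ∈ level K k ↔ σ ∈ K.faces ∧ #σ = k := by
  simp [level]

theorem fVector_eq (d : ℕ) (i : Fin (d + 1)) : K.fVector d i = #(level K (i + 1)) := by
  rw [PreAbstractSimplicialComplex.fVector, ← Set.ncard_coe_finset]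
  congr 1
  ext σ
  simp [level]

theorem subset_mem_level {k l : ℕ} {σ τ : Finset V} (hσ : σ ∈ level K k) (h : τ ⊆ σ) (hc : #τ = l)
    (hl : 0 < l) : τ ∈ level K l :=
  mem_level.mpr ⟨face_mono (mem_level.mp hσ).1 h (card_pos.mp (by omega)), hc⟩

variable [DecidableEq V]

theorem filter_level_subset {k l : ℕ} {σ : Finset V} (hσ : σ ∈ level K k) (hl : 0 < l) :
    {τ ∈ level K l | τ ⊆ σ} = powersetCard l σ := by
  ext τ
  rw [mem_filter, mem_powersetCard]
  exact ⟨fun h => ⟨h.2, (mem_level.mp h.1).2⟩, fun h => ⟨subset_mem_level hσ h.1 h.2 hl, h.1⟩⟩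

/-- The combinatorial properties of a triangulated three-sphere that the collapsing argument
uses. -/
structure IsPseudoSphere (S : PreAbstractSimplicialComplex V) (v n : ℕ) : Prop where
  card_one : #(level S 1) = v
  card_two : #(level S 2) = v + n
  card_three : #(level S 3) = 2 * n
  card_four : #(level S 4) = n
  pure : S.IsPure 3
  two_le_degree : ∀ τ ∈ level S 3, 2 ≤ degree (level S 4) τ
  exists_common : ∀ P : Finset V → Prop, ∀ σ₁ ∈ level S 4, ∀ σ₂ ∈ level S 4, P σ₁ → ¬ P σ₂ →
    ∃ σ ∈ level S 4, ∃ σ' ∈ level S 4, P σ ∧ ¬ P σ' ∧ ∃ τ, τ ⊆ σ ∧ τ ⊆ σ' ∧ #τ = 3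
  exists_coboundary : ∀ z : V → V → ZMod 2,
    (∀ a b c, {a, b, c} ∈ S.faces → z a b + z b c = z a c) →
    ∃ f : V → ZMod 2, ∀ a b, {a, b} ∈ S.faces → z a b = f a + f b

theorem isPseudoSphere (hS : S.IsSphereTriangulation 3) {v n : ℕ}
    (hf : S.fVector 3 = ![v, v + n, 2 * n, n]) : IsPseudoSphere S v n := by
  obtain ⟨hpure, ⟨φ⟩⟩ := hS
  have h : ∀ i, #(level S ((i : Fin 4) + 1)) = (![v, v + n, 2 * n, n] : Fin 4 → ℕ) i := by
    intro i
    rw [← hf, fVector_eq]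
  refine ⟨h 0, h 1, h 2, h 3, hpure, fun τ hτ => ?_, fun P σ₁ h₁ σ₂ h₂ hP₁ hP₂ => ?_,
    exists_coboundary φ⟩
  · rw [mem_level] at hτ
    obtain ⟨σ, hσ, hτσ, hσ4⟩ := hpure τ hτ.1
    obtain ⟨σ', hσ', hσ4', hτσ', hne⟩ := exists_second_tetrahedron φ hpure hσ hσ4 hτσ hτ.2
    rw [← card_pair hne]
    refine card_le_card ?_
    simp [insert_subset_iff, mem_level, hσ, hσ', hσ4, hσ4', hτσ, hτσ']
  · rw [mem_level] at h₁ h₂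
    obtain ⟨σ, hσ, σ', hσ', hc, hc', hP, hP', τ, h⟩ :=
      exists_common_triangle φ hpure P h₁.1 h₂.1 h₁.2 h₂.2 hP₁ hP₂
    exact ⟨σ, mem_level.mpr ⟨hσ, hc⟩, σ', mem_level.mpr ⟨hσ', hc'⟩, hP, hP', τ, h⟩

variable {v n : ℕ}

/-- Each triangle lies in at least two tetrahedra, and double counting with the given $f$-vector
yields $4n=2\cdot 2n$ incidences, leaving no room for more. -/
theorem IsPseudoSphere.degree_eq_two (h : IsPseudoSphere S v n) {τ : Finset V}
    (hτ : τ ∈ level S 3) : degree (level S 4) τ = 2 := by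
  have h1 := (sum_eq_sum_iff_of_le h.two_le_degree).mp (by
    rw [sum_degree, sum_const, smul_eq_mul, h.card_three,
      sum_congr rfl (fun σ hσ => by rw [filter_level_subset hσ (by norm_num), card_powersetCard,
        (mem_level.mp hσ).2]), sum_const, h.card_four, smul_eq_mul]
    simp only [Nat.choose]
    ring)
  exact (h1 τ hτ).symm

/-- A proper nonempty set of tetrahedra has a free triangle. -/
theorem IsPseudoSphere.exists_degree_eq_one (h : IsPseudoSphere S v n) {R : Finset (Finset V)}
    (hR : R ⊆ level S 4) (hne : R.Nonempty) (hne' : R ≠ level S 4) :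
    ∃ τ ∈ level S 3, degree R τ = 1 := by
  obtain ⟨σ₁, h₁⟩ := hne
  obtain ⟨σ₂, h₂, h₂'⟩ := exists_of_ssubset (hR.ssubset_of_ne hne')
  obtain ⟨σ, -, σ', hσ', hP, hP', τ, hτ, hτ', hc⟩ :=
    h.exists_common (· ∈ R) σ₁ (hR h₁) σ₂ h₂ h₁ h₂'
  have hτ3 : τ ∈ level S 3 := subset_mem_level (hR hP) hτ hc (by norm_num)
  refine ⟨τ, hτ3, ?_⟩
  have h3 := degree_sdiff hR τ
  rw [h.degree_eq_two hτ3] at h3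
  have h4 : 0 < degree R τ := degree_pos_iff.mpr ⟨σ, hP, hτ⟩
  have h5 : 0 < degree (level S 4 \ R) τ :=
    degree_pos_iff.mpr ⟨σ', mem_sdiff.mpr ⟨hσ', hP'⟩, hτ'⟩
  omega

theorem filter_singletons {a b : V} (hab : {a, b} ∈ level K 2) :
    {s ∈ level K 1 | s ⊆ {a, b}} = {{a}, {b}} := by
  rw [filter_level_subset hab Nat.one_pos]
  ext s
  rw [mem_powersetCard, card_eq_one]
  constructor
  · rintro ⟨hs, c, rfl⟩
    simpa using hs
  · intro hs
    rcases mem_insert.mp hs with rfl | hs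
    · exact ⟨by simp, a, rfl⟩
    · rw [mem_singleton] at hs
      subst hs
      exact ⟨by simp, b, rfl⟩

theorem filter_pairs {a b c : V} (hab : a ≠ b) (hac : a ≠ c) (hbc : b ≠ c)
    (h : {a, b, c} ∈ level K 3) :
    {e ∈ level K 2 | e ⊆ {a, b, c}} = {{a, b}, {b, c}, {a, c}} := by
  rw [filter_level_subset h (by norm_num)]
  symm
  have hd : #({{a, b}, {b, c}, {a, c}} : Finset (Finset V)) = 3 := by
    refine card_eq_three.mpr ⟨_, _, _, ?_, ?_, ?_, rfl⟩
    · intro h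
      have : a ∈ ({b, c} : Finset V) := h ▸ mem_insert_self a _
      simp [hab, hac] at this
    · intro h
      have : b ∈ ({a, c} : Finset V) := h ▸ by simp
      simp [hab.symm, hbc] at this
    · intro h
      have : b ∈ ({a, c} : Finset V) := h ▸ by simp
      simp [hab.symm, hbc] at this
  refine eq_of_subset_of_card_le ?_ ?_
  · simp only [insert_subset_iff, singleton_subset_iff, mem_powersetCard, card_pair hab,
      card_pair hbc, card_pair hac, and_true]
    simp
  · rw [hd, card_powersetCard, (mem_level.mp h).2]
    rfl

/-- Every `1`-cocycle is a coboundary, in terms of incidence matrices. -/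
theorem IsPseudoSphere.mem_range_of_cocycle (h : IsPseudoSphere S v n) (x : level S 2 → ZMod 2)
    (hx : (incidence (level S 2) (level S 3)).transpose.mulVec x = 0) :
    ∃ y, (incidence (level S 1) (level S 2)).transpose.mulVec y = x := by
  let g : Finset V → ZMod 2 := fun e => if he : e ∈ level S 2 then x ⟨e, he⟩ else 0
  have hg : ∀ e : level S 2, g e = x e := fun e => dif_pos e.2
  have hg0 : ∀ a, g {a} = 0 := fun a => dif_neg fun h => by
    have := (mem_level.mp h).2
    simp at this
  obtain ⟨f, hf⟩ := h.exists_coboundary (fun a b => g {a, b}) (by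
    intro a b c habc
    by_cases hab : a = b
    · subst hab
      simp [hg0]
    by_cases hbc : b = c
    · subst hbc
      simp [hg0]
    by_cases hac : a = c
    · subst hac
      simp only [pair_comm b a, pair_eq_singleton, hg0]
      generalize g {a, b} = y
      revert y
      decide
    have h3 : {a, b, c} ∈ level S 3 :=
      mem_level.mpr ⟨habc, card_eq_three.mpr ⟨a, b, c, hab, hac, hbc, rfl⟩⟩
    have h1 := incidence_transpose_mulVec (A := level S 2) (B := level S 3) g ⟨_, h3⟩
    have h2 : (fun e : level S 2 => g e) = x := funext hg
    rw [h2, hx, filter_pairs hab hac hbc h3, sum_insert, sum_insert, sum_singleton] at h1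
    · change 0 = g {a, b} + (g {b, c} + g {a, c}) at h1
      generalize g {a, b} = p at *
      generalize g {b, c} = q at *
      generalize g {a, c} = r at *
      revert h1
      clear hg hg0
      revert p q r
      decide
    · rw [mem_singleton]
      intro h
      have : b ∈ ({a, c} : Finset V) := h ▸ by simp
      simp [Ne.symm hab, hbc] at this
    · simp only [mem_insert, mem_singleton, not_or]
      constructor
      · intro h
        have : a ∈ ({b, c} : Finset V) := h ▸ by simp
        simp [hab, hac] at this
      · intro h
        have : b ∈ ({a, c} : Finset V) := h ▸ by simp
        simp [Ne.symm hab, hbc] at this)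
  refine ⟨fun s => ∑ i ∈ s.1, f i, funext fun e => ?_⟩
  obtain ⟨e, he⟩ := e
  obtain ⟨a, b, hab, rfl⟩ := card_eq_two.mp (mem_level.mp he).2
  rw [incidence_transpose_mulVec (fun s => ∑ i ∈ s, f i), filter_singletons he,
    sum_pair (by simpa using hab), sum_singleton, sum_singleton, ← hf a b (mem_level.mp he).1,
    hg ⟨_, he⟩]

/-- Since 1-cocycles are coboundaries and constants die under $\delta^0$, the cocycle space has
dimension at most $v-1$, out of $v+n$ edges. -/
theorem IsPseudoSphere.le_rank_two (h : IsPseudoSphere S v n) (hv : 0 < v) :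
    n + 1 ≤ (incidence (level S 2) (level S 3)).rank := by
  set D₁ := (incidence (level S 1) (level S 2)).transpose
  set D₂ := (incidence (level S 2) (level S 3)).transpose with hD₂
  have h1 : LinearMap.ker D₂.mulVecLin ≤ LinearMap.range D₁.mulVecLin := by
    intro x hx
    obtain ⟨y, hy⟩ := h.mem_range_of_cocycle x hx
    exact ⟨y, hy⟩
  have h2 := Submodule.finrank_mono h1
  have h3 := D₁.mulVecLin.finrank_range_add_finrank_ker
  have h4 := D₂.mulVecLin.finrank_range_add_finrank_ker
  rw [Module.finrank_fintype_fun_eq_card, Fintype.card_coe] at h3 h4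
  rw [h.card_one] at h3
  rw [h.card_two] at h4
  have h5 : 0 < Module.finrank (ZMod 2) (LinearMap.ker D₁.mulVecLin) := by
    rw [Module.finrank_pos_iff_exists_ne_zero]
    obtain ⟨s, hs⟩ : (level S 1).Nonempty := card_pos.mp (by rw [h.card_one]; exact hv)
    refine ⟨⟨fun _ => 1, ?_⟩, fun h0 => ?_⟩
    · rw [LinearMap.mem_ker, Matrix.mulVecLin_apply]
      funext e
      obtain ⟨e, he⟩ := e
      obtain ⟨a, b, hab, rfl⟩ := card_eq_two.mp (mem_level.mp he).2
      rw [incidence_transpose_mulVec (fun _ => 1), filter_singletons he,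
        sum_pair (by simpa using hab)]
      rfl
    · have := congrFun (congrArg Subtype.val h0) ⟨s, hs⟩
      simp at this
  have h6 : (incidence (level S 2) (level S 3)).rank =
      Module.finrank (ZMod 2) (LinearMap.range D₂.mulVecLin) := by
    rw [← Matrix.rank_transpose, ← hD₂]
    rfl
  omega

/-- Every `2`-cycle of a triangulated three-sphere is the boundary of a set of tetrahedra. -/
theorem IsPseudoSphere.exists_boundary_eq (h : IsPseudoSphere S v n) (hv : 0 < v)
    {Z : Finset (Finset V)} (hZ : Z ⊆ level S 3) (heven : ∀ e ∈ level S 2, Even (degree Z e)) :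
    ∃ R ⊆ level S 4, ∀ τ ∈ level S 3, (τ ∈ Z ↔ Odd (degree R τ)) := by
  set D₂ := incidence (level S 2) (level S 3)
  set D₃ := incidence (level S 3) (level S 4)
  have h23 : D₂ * D₃ = 0 := incidence_mul_incidence (k := 2) (fun a ha => (mem_level.mp ha).2)
    (fun a ha => (mem_level.mp ha).2) (fun a ha => (mem_level.mp ha).2)
    (fun c hc b hb hbc => subset_mem_level hc hb hbc (by norm_num))
  have h1 : LinearMap.range D₃.mulVecLin ≤ LinearMap.ker D₂.mulVecLin := by
    rintro _ ⟨x, rfl⟩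
    simp [Matrix.mulVec_mulVec, h23]
  have h2 := D₂.mulVecLin.finrank_range_add_finrank_ker
  rw [Module.finrank_fintype_fun_eq_card, Fintype.card_coe, h.card_three] at h2
  have h3 : n + 1 ≤ Module.finrank (ZMod 2) (LinearMap.range D₂.mulVecLin) := h.le_rank_two hv
  -- By strong connectedness $\partial_3$ has kernel of dimension at most one, so its rank is at
  -- least $n-1$. The kernel of $\partial_2$ has dimension at most $2n-(n+1)$, so the image of
  -- $\partial_3$ fills it.
  have h4 : Fintype.card (level S 4) ≤ D₃.rank + 1 := by
    refine card_le_rank_add_one (fun _ => 1) fun x hx => ?_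
    obtain ⟨R, hR, rfl⟩ := exists_eq_indicator _ x
    rw [incidence_mulVec_indicator_eq_zero_iff hR] at hx
    by_cases hR4 : R = level S 4
    · right
      funext σ
      simp [indicator, hR4]
    rcases R.eq_empty_or_nonempty with rfl | hne
    · left
      funext σ
      simp [indicator]
    · obtain ⟨τ, hτ, h1⟩ := h.exists_degree_eq_one hR hne hR4
      have := hx τ hτ
      rw [h1] at this
      exact absurd this (by decide)
  rw [Fintype.card_coe, h.card_four] at h4
  have h5 : D₃.rank = Module.finrank (ZMod 2) (LinearMap.range D₃.mulVecLin) := rfl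
  have h6 := Submodule.eq_of_le_of_finrank_le h1 (by omega)
  have h7 : indicator (level S 3) Z ∈ LinearMap.range D₃.mulVecLin := by
    rw [h6]
    exact (incidence_mulVec_indicator_eq_zero_iff hZ).mpr heven
  obtain ⟨x, hx⟩ := h7
  obtain ⟨R, hR, rfl⟩ := exists_eq_indicator _ x
  refine ⟨R, hR, fun τ hτ => ?_⟩
  have h8 := congrFun hx ⟨τ, hτ⟩
  rw [Matrix.mulVecLin_apply, incidence_mulVec_indicator hR] at h8
  simp only [indicator] at h8
  rw [← ZMod.natCast_eq_one_iff_odd, h8]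
  split_ifs with h9 <;> simp [h9]

end SphereHomology

/-! ### Elementary collapses, their invariants and the terminal complex. -/

namespace Collapse

open Finset FaceFamily SphereTopology SphereHomology PreAbstractSimplicialComplex

universe u

variable {V : Type u} {S K L : PreAbstractSimplicialComplex V}

theorem card_le_of_isPure {d : ℕ} (hS : S.IsPure d) {σ : Finset V} (hσ : σ ∈ S.faces) :
    #σ ≤ d + 1 := by
  obtain ⟨τ, -, h, hc⟩ := hS σ hσ
  exact hc ▸ card_le_card h

theorem notMem_removeFace {δ τ : Finset V} (h : δ ⊆ τ) : τ ∉ (K.removeFace δ).faces :=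
  fun h1 => h1.2 h

section

variable [DecidableEq V]

/-- A free face is contained in only one other face. -/
theorem exists_partner {δ : Finset V} (h : K.IsFree δ) :
    ∃ τ ∈ K.faces, δ ⊆ τ ∧ #τ = #δ + 1 ∧ ∀ ρ ∈ K.faces, δ ⊆ ρ → ρ = δ ∨ ρ = τ := by
  obtain ⟨-, τ, ⟨hτ, hδτ, hc⟩, huniq⟩ := h
  -- Every vertex that a larger face adds to `δ` already produces a face one dimension up, which
  -- must be the unique `τ`.
  have key : ∀ ρ ∈ K.faces, δ ⊆ ρ → ∀ x ∈ ρ, x ∉ δ → insert x δ = τ := fun ρ hρ hδρ x hx hxδ =>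
    huniq _ ⟨face_mono hρ (insert_subset hx hδρ) (insert_nonempty x δ), subset_insert x δ,
      card_insert_of_notMem hxδ⟩
  refine ⟨τ, hτ, hδτ, hc, fun ρ hρ hδρ => ?_⟩
  by_cases h : ρ ⊆ δ
  · exact Or.inl (h.antisymm hδρ)
  obtain ⟨x, hx, hxδ⟩ := not_subset.mp h
  refine Or.inr (Subset.antisymm (fun y hy => ?_) ?_)
  · by_cases hyδ : y ∈ δ
    · exact hδτ hyδ
    · exact key ρ hρ hδρ y hy hyδ ▸ mem_insert_self y δ
  · exact key ρ hρ hδρ x hx hxδ ▸ insert_subset hx hδρ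

/-- The `1`-skeleton is connected, in terms of locally constant functions. -/
def IsConnected (K : PreAbstractSimplicialComplex V) : Prop :=
  ∀ f : V → ZMod 2, (∀ a b, {a, b} ∈ K.faces → f a = f b) →
    ∀ a b, {a} ∈ K.faces → {b} ∈ K.faces → f a = f b

/-- If a vertex is removed, a locally constant function extends over it by the value at its only
neighbour. If an edge is removed, its ends are still joined through the third vertex of the removed
triangle. -/
theorem IsConnected.removeFace (hK : IsConnected K) {δ : Finset V} (hδ : K.IsFree δ) :
    IsConnected (K.removeFace δ) := by
  obtain ⟨τ, hτ, hδτ, hc, h⟩ := exists_partner hδ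
  intro f hf a b ha hb
  have hne : δ.Nonempty := (K.isRelLowerSet_faces hδ.1).1
  by_cases h1 : #δ = 1
  · obtain ⟨x, rfl⟩ := card_eq_one.mp h1
    obtain ⟨y, hy⟩ : ∃ y, τ \ {x} = {y} := card_eq_one.mp (by
      rw [card_sdiff_of_subset hδτ, hc]
      simp)
    have hyx : y ≠ x := by
      have : y ∈ τ \ {x} := hy ▸ mem_singleton_self y
      simpa using (mem_sdiff.mp this).2
    have hτxy : τ = {x, y} := by
      rw [← sdiff_union_of_subset hδτ, hy]
      ext
      simp [or_comm]
    have hax : a ≠ x := fun h => ha.2 (by simp [h])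
    have hbx : b ≠ x := fun h => hb.2 (by simp [h])
    have h2 := hK (Function.update f x (f y)) (fun c d hcd => by
      by_cases hs : {x} ⊆ ({c, d} : Finset V)
      · rcases h _ hcd hs with h3 | h3
        · have hcx : c ∈ ({x} : Finset V) := h3 ▸ by simp
          have hdx : d ∈ ({x} : Finset V) := h3 ▸ by simp
          rw [mem_singleton.mp hcx, mem_singleton.mp hdx]
        · rw [hτxy] at h3
          have key : ∀ c ∈ ({x, y} : Finset V), Function.update f x (f y) c = f y := by
            intro c hc
            rcases mem_insert.mp hc with rfl | hc
            · simp
            · rw [mem_singleton.mp hc, Function.update_of_ne hyx]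
          rw [key c (h3 ▸ by simp), key d (h3 ▸ by simp)]
      · have h3 := hf c d ⟨hcd, hs⟩
        simp only [singleton_subset_iff, mem_insert, mem_singleton, not_or] at hs
        rwa [Function.update_of_ne (Ne.symm hs.1), Function.update_of_ne (Ne.symm hs.2)])
      a b ha.1 hb.1
    rwa [Function.update_of_ne hax, Function.update_of_ne hbx] at h2
  · refine hK f (fun c d hcd => ?_) a b ha.1 hb.1
    by_cases hs : δ ⊆ {c, d}
    · have hcard := card_le_card hs
      have h2 := card_le_two (a := c) (b := d)
      have h3 := hne.card_pos
      have h4 : δ = {c, d} := eq_of_subset_of_card_le hs (by omega)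
      obtain ⟨z, hz⟩ : ∃ z, τ \ δ = {z} := card_eq_one.mp (by
        rw [card_sdiff_of_subset hδτ, hc]
        simp)
      have hzm : z ∈ τ \ δ := hz ▸ mem_singleton_self z
      rw [mem_sdiff] at hzm
      have key : ∀ c ∈ δ, f c = f z := fun e he => hf e z ⟨face_mono hτ
        (insert_subset (hδτ he) (singleton_subset_iff.mpr hzm.1)) (insert_nonempty _ _), fun h5 => by
          have h6 : δ = {e, z} := eq_of_subset_of_card_le h5 (by
            have := card_le_two (a := e) (b := z)
            omega)
          exact hzm.2 (h6 ▸ by simp)⟩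
      rw [key c (h4 ▸ by simp), key d (h4 ▸ by simp)]
    · exact hf c d ⟨hcd, hs⟩

end

variable [Fintype V]

open Classical in
/-- The faces of `K` as a finite set. -/
noncomputable def faceSet (K : PreAbstractSimplicialComplex V) : Finset (Finset V) :=
  {σ | σ ∈ K.faces}

theorem mem_faceSet {σ : Finset V} : σ ∈ faceSet K ↔ σ ∈ K.faces := by
  simp [faceSet]

/-- The negative of the Euler characteristic. -/
noncomputable def alternatingSum (K : PreAbstractSimplicialComplex V) : ℤ :=
  ∑ σ ∈ faceSet K, (-1) ^ #σ

theorem alternatingSum_eq (h : ∀ σ ∈ K.faces, #σ ≤ 4) :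
    alternatingSum K = -#(level K 1) + #(level K 2) - #(level K 3) + #(level K 4) := by
  rw [alternatingSum, ← sum_fiberwise_of_maps_to (g := card) (t := Icc 1 4)]
  · have h1 : ∀ k, ∑ σ ∈ faceSet K with #σ = k, (-1 : ℤ) ^ #σ = (-1) ^ k * #(level K k) := by
      intro k
      have h2 : {σ ∈ faceSet K | #σ = k} = level K k := by
        ext σ
        rw [mem_filter, mem_faceSet, mem_level]
      rw [h2, sum_congr rfl fun σ hσ => by rw [(mem_level.mp hσ).2], sum_const, nsmul_eq_mul,
        mul_comm]
    rw [sum_congr rfl fun k _ => h1 k, show Icc 1 4 = ({1, 2, 3, 4} : Finset ℕ) from rfl]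
    simp
    ring
  · intro σ hσ
    rw [mem_faceSet] at hσ
    exact mem_Icc.mpr ⟨card_pos.mpr (K.isRelLowerSet_faces hσ).1, h σ hσ⟩

theorem exists_collapsesTo_not_isFree (K : PreAbstractSimplicialComplex V) :
    ∃ L : PreAbstractSimplicialComplex V, K.CollapsesTo L ∧ ∀ δ, ¬ L.IsFree δ := by
  induction hm : #(faceSet K) using Nat.strong_induction_on generalizing K with
  | _ m ih =>
    by_cases hK : ∀ δ, ¬ K.IsFree δ
    · exact ⟨K, .refl, hK⟩
    · push Not at hK
      obtain ⟨δ, hδ⟩ := hK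
      have hlt : #(faceSet (K.removeFace δ)) < m := by
        rw [← hm]
        refine card_lt_card ⟨fun σ hσ => mem_faceSet.mpr (mem_faceSet.mp hσ).1, fun hs => ?_⟩
        exact notMem_removeFace subset_rfl (mem_faceSet.mp (hs (mem_faceSet.mpr hδ.1)))
      obtain ⟨L, hL, hfree⟩ := ih _ hlt (K.removeFace δ) rfl
      exact ⟨L, .head ⟨δ, hδ, rfl⟩ hL, hfree⟩

variable [DecidableEq V]

theorem faceSet_removeFace {δ τ : Finset V} (hδ : δ ∈ K.faces) (hτ : τ ∈ K.faces) (hδτ : δ ⊆ τ)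
    (h : ∀ ρ ∈ K.faces, δ ⊆ ρ → ρ = δ ∨ ρ = τ) :
    faceSet K = insert δ (insert τ (faceSet (K.removeFace δ))) := by
  ext ρ
  simp only [mem_insert, mem_faceSet]
  constructor
  · intro hρ
    by_cases hs : δ ⊆ ρ
    · rcases h ρ hρ hs with h | h <;> simp [h]
    · exact Or.inr (Or.inr ⟨hρ, hs⟩)
  · rintro (rfl | rfl | h)
    · exact hδ
    · exact hτ
    · exact h.1

theorem alternatingSum_removeFace {δ : Finset V} (hδ : K.IsFree δ) :
    alternatingSum (K.removeFace δ) = alternatingSum K := by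
  obtain ⟨τ, hτ, hδτ, hc, h⟩ := exists_partner hδ
  have hne : δ ≠ τ := fun h => by rw [h] at hc; omega
  rw [alternatingSum, alternatingSum, faceSet_removeFace hδ.1 hτ hδτ h, sum_insert, sum_insert, hc]
  · ring
  · rw [mem_faceSet]
    exact notMem_removeFace hδτ
  · rw [mem_insert, not_or, mem_faceSet]
    exact ⟨hne, notMem_removeFace subset_rfl⟩

/-- The properties of a complex obtained from the sphere `S` by removing the tetrahedron `Δ` and
collapsing. -/
structure IsRemnant (S : PreAbstractSimplicialComplex V) (Δ : Finset V)
    (K : PreAbstractSimplicialComplex V) : Prop where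
  subset : K.faces ⊆ S.faces
  notMem : Δ ∉ K.faces
  -- Removed tetrahedra are linked to `Δ` through removed triangles, so a set cut off from `Δ` by
  -- triangles of `K` cannot contain one of them.
  mem_of_boundary : ∀ R ⊆ level S 4, Δ ∉ R →
    (∀ τ ∈ level S 3, Odd (degree R τ) → τ ∈ K.faces) → ∀ σ ∈ R, σ ∈ K.faces
  alternatingSum_eq : alternatingSum K = -1
  isConnected : IsConnected K

/-- For `mem_of_boundary`: if a collapse removed a tetrahedron of `R`, its free triangle would lie
in exactly one member of `R`, hence in the boundary of `R`, which is assumed to survive. -/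
theorem IsRemnant.removeFace {Δ : Finset V} (hS : S.IsPure 3) (h : IsRemnant S Δ K) {δ : Finset V}
    (hδ : K.IsFree δ) : IsRemnant S Δ (K.removeFace δ) where
  subset := fun _ hσ => h.subset hσ.1
  notMem := fun hΔ => h.notMem hΔ.1
  mem_of_boundary := by
    intro R hR hΔ hb σ hσ
    have hRK := h.mem_of_boundary R hR hΔ fun τ hτ ho => (hb τ hτ ho).1
    refine ⟨hRK σ hσ, fun hs => ?_⟩
    obtain ⟨τ, hτ, hδτ, hc, hu⟩ := exists_partner hδ
    have hσ4 := (mem_level.mp (hR hσ)).2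
    rcases hu σ (hRK σ hσ) hs with rfl | rfl
    · have := card_le_of_isPure hS (h.subset hτ)
      omega
    · have hδ3 : δ ∈ level S 3 := mem_level.mpr ⟨h.subset hδ.1, by omega⟩
      have h1 : degree R δ = 1 := card_eq_one.mpr ⟨σ, by
        ext ρ
        rw [mem_filter, mem_singleton]
        constructor
        · rintro ⟨hρ, hδρ⟩
          rcases hu ρ (hRK ρ hρ) hδρ with rfl | h2
          · have := (mem_level.mp (hR hρ)).2
            omega
          · exact h2
        · rintro rfl
          exact ⟨hσ, hs⟩⟩
      exact (hb δ hδ3 (by rw [h1]; exact odd_one)).2 subset_rfl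
  alternatingSum_eq := by rw [alternatingSum_removeFace hδ, h.alternatingSum_eq]
  isConnected := h.isConnected.removeFace hδ

theorem isConnected_of_isPseudoSphere {v n : ℕ} (h : IsPseudoSphere S v n) : IsConnected S := by
  intro f hf a b ha hb
  have hconst : ∀ σ ∈ S.faces, ∀ i ∈ σ, ∀ j ∈ σ, f i = f j := fun σ hσ i hi j hj =>
    hf i j (face_mono hσ (insert_subset hi (singleton_subset_iff.mpr hj)) (insert_nonempty _ _))
  obtain ⟨σ₁, h₁, ha₁, hc₁⟩ := h.pure _ ha
  obtain ⟨σ₂, h₂, hb₂, hc₂⟩ := h.pure _ hb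
  rw [singleton_subset_iff] at ha₁ hb₂
  by_contra hab
  obtain ⟨σ, hσ, σ', hσ', ⟨i, hi, hia⟩, hP', τ, hτ, hτ', hc⟩ := h.exists_common
    (fun σ => ∃ i ∈ σ, f i = f a) σ₁ (mem_level.mpr ⟨h₁, hc₁⟩) σ₂ (mem_level.mpr ⟨h₂, hc₂⟩)
    ⟨a, ha₁, rfl⟩ (fun ⟨i, hi, hia⟩ => hab (hia ▸ hconst σ₂ h₂ i hi b hb₂))
  obtain ⟨j, hj⟩ := card_pos.mp (by omega : 0 < #τ)
  exact hP' ⟨j, hτ' hj, (hconst σ (mem_level.mp hσ).1 j (hτ hj) i hi).trans hia⟩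

theorem isRemnant_removeFace {v n : ℕ} (h : IsPseudoSphere S v n) {Δ : Finset V}
    (hΔ : Δ ∈ level S 4) : IsRemnant S Δ (S.removeFace Δ) := by
  rw [mem_level] at hΔ
  have hmem : ∀ σ ∈ S.faces, σ ≠ Δ → σ ∈ (S.removeFace Δ).faces := fun σ hσ hne =>
    ⟨hσ, fun hs => hne (eq_of_subset_of_card_le hs (by
      have := card_le_of_isPure h.pure hσ
      omega)).symm⟩
  refine ⟨fun σ hσ => hσ.1, notMem_removeFace subset_rfl,
    fun R hR hΔR _ σ hσ => hmem σ (mem_level.mp (hR hσ)).1 (fun h => hΔR (h ▸ hσ)), ?_, ?_⟩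
  · have h1 := alternatingSum_eq fun σ hσ => card_le_of_isPure h.pure hσ
    rw [h.card_one, h.card_two, h.card_three, h.card_four] at h1
    have h2 : faceSet S = insert Δ (faceSet (S.removeFace Δ)) := by
      ext σ
      rw [mem_insert, mem_faceSet, mem_faceSet]
      constructor
      · intro hσ
        by_cases hne : σ = Δ
        · exact Or.inl hne
        · exact Or.inr (hmem σ hσ hne)
      · rintro (rfl | h)
        · exact hΔ.1
        · exact h.1
    rw [alternatingSum, h2, sum_insert (by
      rw [mem_faceSet]
      exact notMem_removeFace subset_rfl), hΔ.2] at h1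
    push_cast at h1
    change _ + alternatingSum _ = _ at h1
    linarith
  · intro f hf a b ha hb
    refine isConnected_of_isPseudoSphere h f (fun c d hcd => hf c d (hmem _ hcd fun h => ?_)) a b
      ha.1 hb.1
    have := card_le_two (a := c) (b := d)
    rw [h] at this
    omega

theorem IsRemnant.of_collapsesTo {Δ : Finset V} (hS : S.IsPure 3) (h : IsRemnant S Δ K)
    (hKL : K.CollapsesTo L) : IsRemnant S Δ L := by
  induction hKL with
  | refl => exact h
  | tail _ h1 ih =>
    obtain ⟨δ, hδ, rfl⟩ := h1
    exact ih.removeFace hS hδ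

theorem degree_level_ne_one (hfree : ∀ δ, ¬ K.IsFree δ) {δ : Finset V} (hne : δ.Nonempty) :
    degree (level K (#δ + 1)) δ ≠ 1 := by
  intro h
  obtain ⟨τ, hτ⟩ := card_eq_one.mp h
  have hmem : ∀ ρ, (ρ ∈ K.faces ∧ #ρ = #δ + 1) ∧ δ ⊆ ρ ↔ ρ = τ := fun ρ => by
    rw [← mem_level, ← mem_filter, hτ, mem_singleton]
  have h1 := (hmem τ).mpr rfl
  exact hfree δ ⟨face_mono h1.1.1 h1.2 hne, τ, ⟨h1.1.1, h1.2, h1.1.2⟩,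
    fun ρ hρ => (hmem ρ).mp ⟨⟨hρ.1, hρ.2.2⟩, hρ.2.1⟩⟩

theorem IsRemnant.level_subset {Δ : Finset V} (h : IsRemnant S Δ K) (k : ℕ) :
    level K k ⊆ level S k := fun _ hσ =>
  mem_level.mpr ⟨h.subset (mem_level.mp hσ).1, (mem_level.mp hσ).2⟩

theorem IsRemnant.level_four_eq_empty {v n : ℕ} (hS : IsPseudoSphere S v n) {Δ : Finset V}
    (hΔ : Δ ∈ level S 4) (h : IsRemnant S Δ K) (hfree : ∀ δ, ¬ K.IsFree δ) : level K 4 = ∅ := by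
  by_contra hne
  obtain ⟨τ, hτ, h1⟩ := hS.exists_degree_eq_one (h.level_subset 4) (nonempty_iff_ne_empty.mpr hne)
    fun h1 => h.notMem (mem_level.mp (h1 ▸ hΔ)).1
  have hc := (mem_level.mp hτ).2
  refine degree_level_ne_one hfree (card_pos.mp (by omega)) (?_ : degree (level K (#τ + 1)) τ = 1)
  rwa [hc]

/-- A set of tetrahedra whose boundary lies in a remnant without tetrahedra is empty or
everything. -/
theorem IsRemnant.eq_empty_or_eq {v n : ℕ} (hS : IsPseudoSphere S v n) {Δ : Finset V}
    (h : IsRemnant S Δ K) (h4 : level K 4 = ∅) {R : Finset (Finset V)}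
    (hR : R ⊆ level S 4) (hb : ∀ τ ∈ level S 3, Odd (degree R τ) → τ ∈ K.faces) :
    R = ∅ ∨ R = level S 4 := by
  have key : ∀ R ⊆ level S 4, Δ ∉ R → (∀ τ ∈ level S 3, Odd (degree R τ) → τ ∈ K.faces) →
      R = ∅ := by
    intro R hR hΔR hb
    refine eq_empty_of_forall_notMem fun σ hσ => ?_
    have h1 : σ ∈ level K 4 :=
      mem_level.mpr ⟨h.mem_of_boundary R hR hΔR hb σ hσ, (mem_level.mp (hR hσ)).2⟩
    simp [h4] at h1
  by_cases hΔR : Δ ∈ R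
  · right
    refine hR.antisymm (sdiff_eq_empty_iff_subset.mp (key _ sdiff_subset (by simp [hΔR]) ?_))
    intro τ hτ ho
    refine hb τ hτ ?_
    have h1 := degree_sdiff hR τ
    rw [hS.degree_eq_two hτ] at h1
    obtain ⟨k, hk⟩ := ho
    exact Nat.odd_iff.mpr (by omega)
  · exact Or.inl (key R hR hΔR hb)

/-- A cycle is the boundary of a set of tetrahedra. That set is empty or everything, and both have
zero boundary because triangles have degree two. -/
theorem IsRemnant.isCore {v n : ℕ} (hS : IsPseudoSphere S v n) (hv : 0 < v) {Δ : Finset V}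
    (h : IsRemnant S Δ K) (h4 : level K 4 = ∅) (hfree : ∀ δ, ¬ K.IsFree δ)
    (h3 : (level K 3).Nonempty) : IsCore (level K 3) where
  card_eq := fun t ht => (mem_level.mp ht).2
  nonempty := h3
  degree_ne_one := fun e he h1 =>
    degree_level_ne_one hfree (card_pos.mp (by omega)) (by rwa [he] : degree (level K (#e + 1)) e = 1)
  eq_empty_of_even := by
    intro Z hZ heven
    obtain ⟨R, hR, hRZ⟩ := hS.exists_boundary_eq hv (hZ.trans (h.level_subset 3))
      fun e he => heven e (mem_level.mp he).2
    refine eq_empty_of_forall_notMem fun τ hτ => ?_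
    have hτ3 := h.level_subset 3 (hZ hτ)
    have hodd := (hRZ τ hτ3).mp hτ
    rcases h.eq_empty_or_eq hS h4 hR fun ρ hρ ho => (mem_level.mp (hZ ((hRZ ρ hρ).mpr ho))).1
      with rfl | rfl
    · simp [degree] at hodd
    · rw [hS.degree_eq_two hτ3] at hodd
      exact absurd hodd (by decide)

/-- Restricted to the triangles missing from `K`, the incidence matrix with tetrahedra still has
kernel of dimension at most one. Its rank is thus at least $n-1$, so at least that many of the $2n$
triangles are missing. -/
theorem IsRemnant.card_level_three_le {v n : ℕ} (hS : IsPseudoSphere S v n) {Δ : Finset V}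
    (h : IsRemnant S Δ K) (h4 : level K 4 = ∅) : #(level K 3) ≤ n + 1 := by
  have h1 : Fintype.card (level S 4) ≤
      (incidence (level S 3 \ level K 3) (level S 4)).rank + 1 := by
    refine card_le_rank_add_one (fun _ => 1) fun x hx => ?_
    obtain ⟨R, hR, rfl⟩ := exists_eq_indicator _ x
    rw [incidence_mulVec_indicator_eq_zero_iff hR] at hx
    rcases h.eq_empty_or_eq hS h4 hR fun τ hτ ho => by
        by_contra hτK
        have := hx τ (mem_sdiff.mpr ⟨hτ, fun h1 => hτK (mem_level.mp h1).1⟩)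
        exact (Nat.not_even_iff_odd.mpr ho) this
      with rfl | rfl
    · left
      funext σ
      simp [indicator]
    · right
      funext σ
      simp [indicator]
  have h2 := (incidence (level S 3 \ level K 3) (level S 4)).rank_le_card_height
  have h3 := card_sdiff_add_card_eq_card (h.level_subset 3)
  rw [Fintype.card_coe] at h1 h2
  rw [hS.card_four] at h1
  rw [hS.card_three] at h3
  omega

theorem IsRemnant.level_three_eq_empty {v n : ℕ} (hS : IsPseudoSphere S v n) (hv : 0 < v)
    (hvn : v < 8 ∨ n < 16) {Δ : Finset V} (h : IsRemnant S Δ K) (h4 : level K 4 = ∅)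
    (hfree : ∀ δ, ¬ K.IsFree δ) : level K 3 = ∅ := by
  by_contra hne
  obtain ⟨h1, h2⟩ := (h.isCore hS hv h4 hfree (nonempty_iff_ne_empty.mpr hne)).bounds
  have h3 := h.card_level_three_le hS h4
  have h5 : #(verts (level K 3)) ≤ #(level S 1) := by
    refine card_le_card_of_injOn (fun a => {a}) (fun a ha => ?_) (singleton_injective.injOn)
    obtain ⟨t, ht, hat⟩ := mem_verts.mp ha
    exact subset_mem_level (h.level_subset 3 ht) (singleton_subset_iff.mpr hat) (card_singleton a)
      Nat.one_pos
  rw [hS.card_one] at h5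
  omega

/-- A connected graph with one more vertex than edges and without free vertices is a point. -/
theorem exists_faces_eq_singleton (hcard : ∀ σ ∈ K.faces, #σ ≤ 2)
    (hsum : #(level K 1) = #(level K 2) + 1) (hconn : IsConnected K)
    (hfree : ∀ δ, ¬ K.IsFree δ) : ∃ x, K.faces = {{x}} := by
  have h2 : level K 2 = ∅ := by
    by_contra hne
    have h1 : 1 ≤ #(level K 2) := card_pos.mpr (nonempty_iff_ne_empty.mpr hne)
    -- With no leaf and no isolated vertex all degrees are at least two, so there are at least as
    -- many edges as vertices, against Euler characteristic 1.
    have hdeg : ∀ s ∈ level K 1, 2 ≤ degree (level K 2) s := by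
      intro s hs
      obtain ⟨a, rfl⟩ := card_eq_one.mp (mem_level.mp hs).2
      have h3 : degree (level K 2) {a} ≠ 1 := degree_level_ne_one hfree (singleton_nonempty a)
      have h4 : 0 < degree (level K 2) {a} := by
        by_contra h4
        obtain ⟨t, ht, hta⟩ := exists_mem_ne (by omega : 1 < #(level K 1)) {a}
        obtain ⟨b, rfl⟩ := card_eq_one.mp (mem_level.mp ht).2
        have hedge : ∀ c, c ≠ a → {a, c} ∉ K.faces := fun c hc hac =>
          h4 (degree_pos_iff.mpr ⟨{a, c}, mem_level.mpr ⟨hac, card_pair hc.symm⟩, by simp⟩)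
        have h5 := hconn (fun c => if c = a then 1 else 0) (fun c d hcd => by
          by_cases hca : c = a <;> by_cases hda : d = a
          · simp [hca, hda]
          · exact absurd (hca ▸ hcd) (hedge d hda)
          · exact absurd (pair_comm c d ▸ hda ▸ hcd) (hda ▸ hedge c hca)
          · simp [hca, hda]) a b (mem_level.mp hs).1 (mem_level.mp ht).1
        have hba : b ≠ a := fun h => hta (by rw [h])
        simp [hba] at h5
      omega
    have h3 := sum_le_sum hdeg
    rw [sum_const, smul_eq_mul, sum_degree, sum_congr rfl fun e he => by
      rw [filter_level_subset he Nat.one_pos, card_powersetCard, (mem_level.mp he).2], sum_const,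
      smul_eq_mul] at h3
    simp only [Nat.choose] at h3
    omega
  rw [h2, card_empty, zero_add] at hsum
  obtain ⟨s, hs⟩ := card_eq_one.mp hsum
  obtain ⟨x, rfl⟩ := card_eq_one.mp (mem_level.mp (hs ▸ mem_singleton_self s)).2
  refine ⟨x, Set.ext fun σ => ?_⟩
  rw [Set.mem_singleton_iff, ← mem_singleton, ← hs, mem_level]
  refine ⟨fun hσ => ⟨hσ, ?_⟩, fun hσ => hσ.1⟩
  have h3 := card_pos.mpr (K.isRelLowerSet_faces hσ).1
  have h4 := hcard σ hσ
  by_contra h5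
  have h6 : σ ∈ level K 2 := mem_level.mpr ⟨hσ, by omega⟩
  simp [h2] at h6

theorem IsRemnant.exists_faces_eq_singleton {v n : ℕ} (hS : IsPseudoSphere S v n) (hv : 0 < v)
    (hvn : v < 8 ∨ n < 16) {Δ : Finset V} (hΔ : Δ ∈ level S 4) (h : IsRemnant S Δ K)
    (hfree : ∀ δ, ¬ K.IsFree δ) : ∃ x, K.faces = {{x}} := by
  have h4 := h.level_four_eq_empty hS hΔ hfree
  have h3 := h.level_three_eq_empty hS hv hvn h4 hfree
  have hc : ∀ σ ∈ K.faces, #σ ≤ 4 := fun σ hσ => card_le_of_isPure hS.pure (h.subset hσ)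
  have h1 := Collapse.alternatingSum_eq hc
  rw [h.alternatingSum_eq, h3, h4, card_empty] at h1
  refine Collapse.exists_faces_eq_singleton (fun σ hσ => ?_) (by omega) h.isConnected hfree
  have h5 := hc σ hσ
  by_contra h6
  have h7 : σ ∈ level K 3 ∨ σ ∈ level K 4 := by
    rw [mem_level, mem_level, ← and_or_left]
    exact ⟨hσ, by omega⟩
  simp [h3, h4] at h7

end Collapse

open Collapse SphereHomology in
theorem corollary4p3 {V : Type*} [Fintype V] (S : PreAbstractSimplicialComplex V)
    (hS : S.IsSphereTriangulation 3) (v n : ℕ)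
    (hf : S.fVector 3 = ![v, v + n, 2 * n, n]) (hvn : v < 8 ∨ n < 16)
    (Δ : Finset V) (hΔ : Δ ∈ S.faces) (hΔ4 : Δ.card = 4) :
    (S.removeFace Δ).IsExtendablyCollapsible := by
  classical
  intro L hL
  have hP := isPseudoSphere hS hf
  have hΔ' : Δ ∈ level S 4 := mem_level.mpr ⟨hΔ, hΔ4⟩
  have hv : 0 < v := by
    obtain ⟨x, hx⟩ := (S.isRelLowerSet_faces hΔ).1
    rw [← hP.card_one, Finset.card_pos]
    exact ⟨{x}, subset_mem_level hΔ' (Finset.singleton_subset_iff.mpr hx)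
      (Finset.card_singleton x) Nat.one_pos⟩
  obtain ⟨K, hLK, hfree⟩ := exists_collapsesTo_not_isFree L
  obtain ⟨x, hx⟩ := (((isRemnant_removeFace hP hΔ').of_collapsesTo hP.pure hL).of_collapsesTo
    hP.pure hLK).exists_faces_eq_singleton hP hv hvn hΔ' hfree
  exact ⟨K, x, hLK, hx⟩
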